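/- **Setting.** Let $\alpha>1$ and let $\gamma=(\gamma_{\mathfrak u})$ be non-negative weights indexed by the finite sets $\mathfrak u\subset\mathbb N$, with $\gamma_\emptyset=1$. For $d\ge 1$ and $h\in\mathbb Z^d$ put $r(h,\gamma)^{-1}:=\gamma_{\operatorname{supp}h}\prod_{j\in\operatorname{supp}h}|h_j|^{-\alpha}$. Let $\mathcal N_{\mathrm{kor},\alpha}$ and $\mathcal N_{\widetilde{\mathrm{kor}},\alpha}$ be the reproducing kernel Hilbert spaces on $[0,1]^d$ of the kernels $$K(x,x')=\sum_{h\in\mathbb Z^d} r(h,\gamma)^{-1}e^{2\pi i h\cdot(x-x')},\qquad \widetilde K(x,x')=\sum_{h\in\mathbb Z^d} r(h,\gamma)^{-2}e^{2\pi i h\cdot(x-x')}.$$ For $z\in\{1,\dots,N\}^d$ let $x_k=\{kz/N\}$ ($k=1,\dots,N$) be the rank-1 lattice points and $V_N=\operatorname{span}\{K(x_k,\cdot):k=1,\dots,N\}$. Given $\lambda>0$ and independent random points $Y_1,\dots,Y_M$ of $[0,1]^d$ with probability density $f$ with respect to Lebesgue measure, let $f^\lambda_{M,N;Y}\in V_N$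 be the solution of $$\langle f^\lambda_{M,N;Y},v\rangle_{L^2([0,1]^d)}+\lambda\langle f^\lambda_{M,N;Y},v\rangle_{\mathrm{kor},\alpha}=\frac1M\sum_{m=1}^M v(Y_m)\quad\text{for all }v\in V_N .$$ For $q>1/\alpha$ let $(\mathrm S_q)$ be the condition $$\sum_{\mathfrak u\subset\mathbb N,\ |\mathfrak u|<\infty}\max(|\mathfrak u|,1)\,\gamma_{\mathfrak u}^{q}\,[2\zeta(\alpha q)]^{|\mathfrak u|}<\infty .$$ **Statement.** There are generating vectors $z=z(d,N)\in\{1,\dots,N\}^d$ ($d\ge1$, $N$ prime), depending only on $d$, $N$, $\alpha$, $\gamma$, such that for all $\delta\in(0,\alpha/4)$, $\epsilon\in(0,1-1/\alpha]$ and $c>0$ the following holds for every $d\ge1$ and $M\ge1$. 1. Let $\lambda^*=M^{-1/(1+1/\alpha+\epsilon)}$ and $e=1/\bigl(\frac\alpha2(1+\epsilon)+\frac12-2\delta(1+\frac1\alpha+\epsilon)\bigr)$. For every prime $N\ge c\,M^{e}$ and every density $f\in\mathcal N_{\mathrm{kor},\alpha}$, the estimator with $\lambda=\lambda^*$ satisfies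 $$\mathbb E\Bigl[\int_{[0,1]^d}|f^{\lambda}_{M,N;Y}(x)-f(x)|^2\,dx\Bigr]\le C_d\,\|f\|_{\mathrm{kor},\alpha}^2\,M^{-1/(1+\frac1\alpha+\epsilon)} .$$ Here $C_d>0$ depends only on $\alpha,\gamma,\delta,\epsilon,c,d$. It can be bounded independently of $d$ provided that $(\mathrm S_q)$ holds for $q=\frac1{\alpha-4\delta}$ and, in case $\frac1{\alpha-4\delta}>\tau^*:=\frac1\alpha+\epsilon$, also for $q=\tau^*$. 2. Let $\lambda^*=M^{-1/(2+1/\alpha+2\epsilon)}$ and $e=1/\bigl(\frac\alpha2(1+\epsilon)+\frac14-2\delta(1+\frac1{2\alpha}+\epsilon)\bigr)$. For every prime $N\ge c\,M^{e}$ and every density $f\in\mathcal N_{\widetilde{\mathrm{kor}},\alpha}$, the estimator with $\lambda=\lambda^*$ satisfies $$\mathbb E\Bigl[\int_{[0,1]^d}|f^{\lambda}_{M,N;Y}(x)-f(x)|^2\,dx\Bigr]\le \widetilde C_d\,\|f\|_{\widetilde{\mathrm{kor}},\alpha}^2\,M^{-1/(1+\frac1{2\alpha}+\epsilon)} .$$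 Here $\widetilde C_d>0$ depends only on $\alpha,\gamma,\delta,\epsilon,c,d$. It can be bounded independently of $d$ provided that $(\mathrm S_q)$ holds for $q=\frac1{\alpha-4\delta}$ and, in case $\frac1{\alpha-4\delta}>\tau^*:=\min(\frac1\alpha+2\epsilon,1)$, also for $q=\tau^*$. In both parts, for every $M\ge1$ there is a prime $N$ with $M^{e}\le N\le 2M^{e}$, so that $N=N^*=\mathcal O(M^{e})$ is an admissible choice. -/

import Mathlib

open MeasureTheory ProbabilityTheory
open scoped NNReal ENNReal

universe u

/-- The `d`-dimensional unit cube `[0,1]^d`, with the uniform (Lebesgue) measure `volume`. -/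
abbrev UnitCube (d : ℕ) : Type := Fin d → unitInterval

/-- The phase `2πi h·x`. -/
noncomputable def fourierPhase {d : ℕ} (h : Fin d → ℤ) (x : Fin d → ℝ) : ℂ :=
  2 * Real.pi * Complex.I * ((∑ j, (h j : ℝ) * x j : ℝ) : ℂ)

/-- The translation-invariant kernel `∑_h ρ(h) e^{2πi h·(x-x')}` with nonnegative coefficients `ρ`
(the real part is taken only to obtain a real number: the series is real when `ρ(-h) = ρ(h)`). -/
noncomputable def fourierKernel {d : ℕ} (ρ : (Fin d → ℤ) → ℝ≥0) (x x' : UnitCube d) : ℝ :=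
  (∑' h : Fin d → ℤ, ((ρ h : ℝ) : ℂ) *
    Complex.exp (fourierPhase h (fun j => (x j : ℝ) - (x' j : ℝ)))).re

/-- A real kernel as a matrix of operators on `ℝ`, the form of Mathlib's reproducing kernel
Hilbert spaces. -/
noncomputable def fourierKernelMatrix {d : ℕ} (ρ : (Fin d → ℤ) → ℝ≥0) :
    Matrix (UnitCube d) (UnitCube d) (ℝ →L[ℝ] ℝ) :=
  Matrix.of fun x x' => fourierKernel ρ x x' • ContinuousLinearMap.id ℝ ℝ

theorem fourierKernel_eq_zero {d : ℕ} {ρ : (Fin d → ℤ) → ℝ≥0}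
    (hρ : ¬ Summable fun h => (ρ h : ℝ)) (x x' : UnitCube d) : fourierKernel ρ x x' = 0 := by
  unfold fourierKernel
  rw [tsum_eq_zero_of_not_summable, Complex.zero_re]
  intro hs
  apply hρ
  convert hs.norm using 2 with h
  simp [fourierPhase, Complex.norm_exp]

theorem fourierKernel_hasSum {d : ℕ} {ρ : (Fin d → ℤ) → ℝ≥0}
    (hρ : Summable fun h => (ρ h : ℝ)) (x x' : UnitCube d) :
    HasSum (fun h : Fin d → ℤ => (ρ h : ℝ) * Real.cos (2 * Real.pi *
      ∑ j, (h j : ℝ) * ((x j : ℝ) - (x' j : ℝ)))) (fourierKernel ρ x x') := by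
  have hs : Summable fun h : Fin d → ℤ => ((ρ h : ℝ) : ℂ) *
      Complex.exp (fourierPhase h (fun j => (x j : ℝ) - (x' j : ℝ))) := by
    apply Summable.of_norm
    convert hρ using 2 with h
    simp [fourierPhase, Complex.norm_exp]
  have h1 : HasSum _ (fourierKernel ρ x x') := Complex.hasSum_re hs.hasSum
  convert h1 using 2 with h
  rw [Complex.re_ofReal_mul]
  simp only [fourierPhase, Complex.exp_re]
  simp

instance fourierKernelMatrix_posSemidef {d : ℕ} (ρ : (Fin d → ℤ) → ℝ≥0) :
    Fact (fourierKernelMatrix ρ).PosSemidef := by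
  refine ⟨(RKHS.posSemidef_tfae.out 0 2).2 ?_⟩
  by_cases hρ : Summable fun h => (ρ h : ℝ)
  swap
  · refine ⟨?_, ?_⟩
    · ext x x'
      simp [fourierKernelMatrix, fourierKernel_eq_zero hρ]
    · intro v
      simp [fourierKernelMatrix, fourierKernel_eq_zero hρ]
  refine ⟨?_, ?_⟩
  · have hsymm : ∀ x x' : UnitCube d, fourierKernel ρ x x' = fourierKernel ρ x' x := by
      intro x x'
      refine (fourierKernel_hasSum hρ x x').unique ?_
      convert fourierKernel_hasSum hρ x' x using 3 with h
      rw [← Real.cos_neg]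
      congr 1
      rw [← mul_neg, ← Finset.sum_neg_distrib]
      congr 1
      exact Finset.sum_congr rfl fun j _ => by ring
    have hadj : ContinuousLinearMap.adjoint (ContinuousLinearMap.id ℝ ℝ) =
        ContinuousLinearMap.id ℝ ℝ := ContinuousLinearMap.adjoint_id
    ext x x'
    simp [fourierKernelMatrix, Matrix.conjTranspose_apply, hsymm x' x,
      ContinuousLinearMap.star_eq_adjoint, hadj]
  · intro v
    simp only [Finsupp.sum, fourierKernelMatrix, Matrix.of_apply, RCLike.re_to_real]
    have key : HasSum (fun h : Fin d → ℤ => ∑ x ∈ v.support, ∑ x' ∈ v.support,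
        (ρ h : ℝ) * Real.cos (2 * Real.pi * ∑ j, (h j : ℝ) * ((x' j : ℝ) - (x j : ℝ))) *
          (v x * v x'))
        (∑ x ∈ v.support, ∑ x' ∈ v.support, fourierKernel ρ x' x * (v x * v x')) :=
      hasSum_sum fun x _ => hasSum_sum fun x' _ =>
        (fourierKernel_hasSum hρ x' x).mul_right _
    have h0 : 0 ≤ ∑ x ∈ v.support, ∑ x' ∈ v.support, fourierKernel ρ x' x * (v x * v x') := by
      refine key.nonneg fun h => ?_
      set θ : UnitCube d → ℝ := fun x => 2 * Real.pi * ∑ j, (h j : ℝ) * (x j : ℝ) with hθ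
      have e : ∑ x ∈ v.support, ∑ x' ∈ v.support, (ρ h : ℝ) *
          Real.cos (2 * Real.pi * ∑ j, (h j : ℝ) * ((x' j : ℝ) - (x j : ℝ))) * (v x * v x')
          = (ρ h : ℝ) * ((∑ x ∈ v.support, v x * Real.cos (θ x)) ^ 2 +
            (∑ x ∈ v.support, v x * Real.sin (θ x)) ^ 2) := by
        rw [sq, sq, Finset.sum_mul_sum, Finset.sum_mul_sum, ← Finset.sum_add_distrib,
          Finset.mul_sum]
        refine Finset.sum_congr rfl fun x _ => ?_
        rw [← Finset.sum_add_distrib, Finset.mul_sum]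
        refine Finset.sum_congr rfl fun x' _ => ?_
        have : 2 * Real.pi * ∑ j, (h j : ℝ) * ((x' j : ℝ) - (x j : ℝ)) = θ x' - θ x := by
          simp only [hθ, mul_sub, Finset.sum_sub_distrib]
        rw [this, Real.cos_sub]
        ring
      rw [e]
      positivity
    convert h0 using 4 with x _ x' _
    simp
    ring

/-- The set `supp h` of the indices of the nonzero entries of `h`. The coordinates are
numbered `0, …, d-1`. -/
def freqSupport {d : ℕ} (h : Fin d → ℤ) : Finset ℕ :=
  (Finset.univ.filter fun j => h j ≠ 0).map Fin.valEmbedding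

/-- The reciprocal `1 / r(h,γ) = γ_{supp h} ∏_{j ∈ supp h} |h_j|^{-α}`; it equals `γ_∅ = 1` for
`h = 0`, and it is `0` (that is, `r(h,γ) = ∞`) when `γ_{supp h} = 0`. -/
noncomputable def korobovCoeff (α : ℝ) (γ : Finset ℕ → ℝ≥0) (d : ℕ) (h : Fin d → ℤ) : ℝ≥0 :=
  γ (freqSupport h) * ∏ j ∈ Finset.univ.filter (fun j => h j ≠ 0), ((h j).natAbs : ℝ≥0) ^ (-α)

/-- The weighted Korobov space: the reproducing kernel Hilbert space on `[0,1]^d` of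
`K(x,x') = ∑_h r(h,γ)⁻¹ e^{2πi h·(x-x')}`. -/
abbrev KorobovSpace (α : ℝ) (γ : Finset ℕ → ℝ≥0) (d : ℕ) : Type :=
  RKHS.OfKernel (fourierKernelMatrix (korobovCoeff α γ d))

/-- The reproducing kernel Hilbert space on `[0,1]^d` of
`K̃(x,x') = ∑_h r(h,γ)⁻² e^{2πi h·(x-x')}`. -/
abbrev KorobovTildeSpace (α : ℝ) (γ : Finset ℕ → ℝ≥0) (d : ℕ) : Type :=
  RKHS.OfKernel (fourierKernelMatrix fun h => korobovCoeff α γ d h ^ 2)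

/-- The `k`-th point `{k z / N}` of the rank-1 lattice with generating vector `z`. -/
noncomputable def latticePoint {d : ℕ} (N : ℕ) (z : Fin d → ℕ) (k : ℕ) : UnitCube d :=
  fun j => ⟨Int.fract ((k : ℝ) * (z j : ℝ) / (N : ℝ)),
    Int.fract_nonneg _, (Int.fract_lt_one _).le⟩

/-- `V_N = span {K(x_k, ·) : k = 1, …, N}` for the rank-1 lattice points `x_k`. -/
noncomputable def latticeSpan (α : ℝ) (γ : Finset ℕ → ℝ≥0) (d N : ℕ) (z : Fin d → ℕ) :
    Submodule ℝ (KorobovSpace α γ d) :=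
  Submodule.span ℝ
    ((fun k => RKHS.kerFun (KorobovSpace α γ d) (latticePoint N z k) 1) '' Set.Icc 1 N)

/-- `g ∈ V_N` and `⟨g, v⟩_{L²} + lam ⟨g, v⟩_K = M⁻¹ ∑_m v(y_m)` for all `v ∈ V_N`. -/
def IsKernelEstimate (α : ℝ) (γ : Finset ℕ → ℝ≥0) {d : ℕ} (N : ℕ) (z : Fin d → ℕ) (lam : ℝ)
    {M : ℕ} (y : Fin M → UnitCube d) (g : KorobovSpace α γ d) : Prop :=
  g ∈ latticeSpan α γ d N z ∧ ∀ v ∈ latticeSpan α γ d N z,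
    (∫ x, g x * v x) + lam * inner ℝ g v = (M : ℝ)⁻¹ * ∑ m, v (y m)

theorem fourierKernel_continuous_left {d : ℕ} (ρ : (Fin d → ℤ) → ℝ≥0) (x' : UnitCube d) :
    Continuous fun x => fourierKernel ρ x x' := by
  by_cases hρ : Summable fun h => (ρ h : ℝ)
  swap
  · simp only [fourierKernel_eq_zero hρ]
    exact continuous_const
  simp only [fun x => (fourierKernel_hasSum hρ x x').tsum_eq.symm]
  refine continuous_tsum (fun h => by fun_prop) hρ fun h x => ?_
  rw [norm_mul, Real.norm_eq_abs, Real.norm_eq_abs, abs_of_nonneg (ρ h).coe_nonneg]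
  exact mul_le_of_le_one_right (ρ h).coe_nonneg (Real.abs_cos_le_one _)

theorem latticeSpan_continuous {α : ℝ} {γ : Finset ℕ → ℝ≥0} {d N : ℕ} {z : Fin d → ℕ}
    {g : KorobovSpace α γ d} (hg : g ∈ latticeSpan α γ d N z) : Continuous fun x => g x := by
  refine Submodule.span_induction ?_ ?_ ?_ ?_ hg
  · rintro _ ⟨k, -, rfl⟩
    simp only [RKHS.kerFun_apply, RKHS.OfKernel.kernel_ofKernel]
    simpa [fourierKernelMatrix] using fourierKernel_continuous_left _ _
  · simpa using continuous_const
  · intro u w _ _ hu hw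
    simp only [RKHS.coe_add, Pi.add_apply]
    exact hu.add hw
  · intro c u _ hu
    simp only [RKHS.coe_smul, Pi.smul_apply]
    exact hu.const_smul c

/-- The variational problem has exactly one solution in `V_N`. -/
theorem existsUnique_isKernelEstimate (α : ℝ) (γ : Finset ℕ → ℝ≥0) {d : ℕ} (N : ℕ)
    (z : Fin d → ℕ) {lam : ℝ} (hlam : 0 < lam) {M : ℕ} (y : Fin M → UnitCube d) :
    ∃! g, IsKernelEstimate α γ N z lam y g := by
  let V := latticeSpan α γ d N z
  have : FiniteDimensional ℝ V :=
    FiniteDimensional.span_of_finite ℝ ((Set.finite_Icc 1 N).image _)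
  have hint : ∀ u w : V, Integrable fun x => (u : KorobovSpace α γ d) x * w.1 x := by
    intro u w
    exact ((latticeSpan_continuous u.2).mul (latticeSpan_continuous w.2)).integrable_of_hasCompactSupport
      (HasCompactSupport.of_compactSpace _)
  let B : V →ₗ[ℝ] V →ₗ[ℝ] ℝ := LinearMap.mk₂ ℝ
    (fun u w => (∫ x, u.1 x * w.1 x) + lam * inner ℝ u.1 w.1)
    (fun u u' w => by
      have : (∫ x, (u + u').1 x * w.1 x) = (∫ x, u.1 x * w.1 x) + ∫ x, u'.1 x * w.1 x := by
        rw [← integral_add (hint u w) (hint u' w)]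
        simp [add_mul]
      rw [this, Submodule.coe_add, inner_add_left]
      ring)
    (fun c u w => by
      have : (∫ x, (c • u).1 x * w.1 x) = c * ∫ x, u.1 x * w.1 x := by
        rw [← integral_const_mul]
        simp [mul_assoc]
      rw [this, Submodule.coe_smul, inner_smul_left, smul_eq_mul]
      simp
      ring)
    (fun u w w' => by
      have : (∫ x, u.1 x * (w + w').1 x) = (∫ x, u.1 x * w.1 x) + ∫ x, u.1 x * w'.1 x := by
        rw [← integral_add (hint u w) (hint u w')]
        simp [mul_add]
      rw [this, Submodule.coe_add, inner_add_right]
      ring)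
    (fun c u w => by
      have : (∫ x, u.1 x * (c • w).1 x) = c * ∫ x, u.1 x * w.1 x := by
        rw [← integral_const_mul]
        simp [mul_left_comm]
      rw [this, Submodule.coe_smul, inner_smul_right, smul_eq_mul]
      ring)
  have hB : ∀ u w : V, B u w = (∫ x, u.1 x * w.1 x) + lam * inner ℝ u.1 w.1 := fun _ _ => rfl
  have hinj : Function.Injective B := by
    refine (injective_iff_map_eq_zero B).2 fun u hu => ?_
    have h1 : (∫ x, u.1 x * u.1 x) + lam * inner ℝ u.1 u.1 = 0 := by
      rw [← hB, hu, LinearMap.zero_apply]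
    have h2 : 0 ≤ ∫ x, u.1 x * u.1 x := integral_nonneg fun x => mul_self_nonneg _
    have h3 : 0 ≤ inner ℝ u.1 u.1 := real_inner_self_nonneg
    have h4 : inner ℝ u.1 u.1 = 0 := by nlinarith [mul_nonneg hlam.le h3]
    exact Subtype.ext (inner_self_eq_zero.1 h4)
  have hsurj : Function.Surjective B :=
    (LinearMap.injective_iff_surjective_of_finrank_eq_finrank
      (Subspace.dual_finrank_eq (K := ℝ) (V := V)).symm).1 hinj
  let F : V →ₗ[ℝ] ℝ :=
    { toFun := fun v => (M : ℝ)⁻¹ * ∑ m, v.1 (y m)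
      map_add' := fun u w => by simp [Finset.sum_add_distrib, mul_add]
      map_smul' := fun c u => by simp [← Finset.mul_sum, mul_left_comm] }
  obtain ⟨g, hg⟩ := hsurj F
  refine ⟨g.1, ⟨g.2, fun v hv => LinearMap.congr_fun hg ⟨v, hv⟩⟩, ?_⟩
  rintro g' ⟨hg', h'⟩
  have : B ⟨g', hg'⟩ = B g := by
    rw [hg]
    exact LinearMap.ext fun v => h' v.1 v.2
  exact congrArg Subtype.val (hinj this)

/-- The kernel estimator `f_{M,N;y}^lam` for the data `y`: the unique solution of the variational
problem (for `lam > 0`). -/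
noncomputable def kernelEstimator (α : ℝ) (γ : Finset ℕ → ℝ≥0) {d : ℕ} (N : ℕ) (z : Fin d → ℕ)
    (lam : ℝ) {M : ℕ} (y : Fin M → UnitCube d) : KorobovSpace α γ d :=
  Classical.epsilon (IsKernelEstimate α γ N z lam y)

theorem kernelEstimator_spec (α : ℝ) (γ : Finset ℕ → ℝ≥0) {d : ℕ} (N : ℕ) (z : Fin d → ℕ)
    {lam : ℝ} (hlam : 0 < lam) {M : ℕ} (y : Fin M → UnitCube d) :
    IsKernelEstimate α γ N z lam y (kernelEstimator α γ N z lam y) :=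
  Classical.epsilon_spec (existsUnique_isKernelEstimate α γ N z hlam y).exists

/-- `Y_1, …, Y_M` are independent random points of the cube with probability density `f`. -/
structure IsSampleOf {Ω : Type*} [MeasurableSpace Ω] (P : Measure Ω) {d M : ℕ}
    (Y : Fin M → Ω → UnitCube d) (f : UnitCube d → ℝ) : Prop where
  nonneg : ∀ x, 0 ≤ f x
  measurable : ∀ m, Measurable (Y m)
  indep : iIndepFun Y P
  law : ∀ m, P.map (Y m) = volume.withDensity fun x => ENNReal.ofReal (f x)

/-- The mean integrated squared error
`E ∫_{[0,1]^d} |f_{M,N;Y}^lam(x) - f(x)|² dx` of the kernel estimator. -/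
noncomputable def mise {Ω : Type*} [MeasurableSpace Ω] (P : Measure Ω) (α : ℝ)
    (γ : Finset ℕ → ℝ≥0) {d : ℕ} (N : ℕ) (z : Fin d → ℕ) (lam : ℝ) {M : ℕ}
    (Y : Fin M → Ω → UnitCube d) (f : UnitCube d → ℝ) : ℝ≥0∞ :=
  ∫⁻ ω, ∫⁻ x, ENNReal.ofReal
    (|kernelEstimator α γ N z lam (fun m => Y m ω) x - f x| ^ 2) ∂volume ∂P

/-- The summability condition
`∑_u max(|u|,1) γ_u^q [2 ζ(α q)]^{|u|} < ∞` over all finite sets `u` of coordinates. -/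
def WeightSummable (α : ℝ) (γ : Finset ℕ → ℝ≥0) (q : ℝ) : Prop :=
  Summable fun u : Finset ℕ => (max u.card 1 : ℝ) * (γ u : ℝ) ^ q *
    (2 * ∑' k : ℕ, ((k : ℝ) + 1) ^ (-(α * q))) ^ u.card

/-! Write `ρ = 1/r`. A function of the Korobov space has Fourier coefficients `√ρ_h w_h` with `w` in
`ℓ²` and norm `‖w‖`, so every estimate becomes one about sequences (`exists_fourierIsometry`). Let
`g₀ ∈ V_N` solve the variational problem with the empirical mean replaced by `∫ f v`. The error
splits into a fluctuation (estimator minus `g₀`) and a bias `g₀ - f` (`mise_le`).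

Fluctuation: in a basis `φ_i` of `V_N` orthonormal for the form `⟨·,·⟩_{L²} + λ⟨·,·⟩_K`, its
coordinates are centred empirical means, and its expected square is at most `M⁻¹ ∫ f Σ φ_i²`. The
sum `Σ φ_i(y)²` is controlled by the norm of evaluation at `y` for the same form, hence by `λ^{-τ}
Σ_h ρ_h^τ` (`sq_apply_le`).

Bias: the Korobov projection `p` of `f` onto `V_N` interpolates `f` on the lattice. The coefficients
of `f - p` therefore sum to zero over each class of frequencies that agree on the lattice; if `s`
bounds the sum of `ρ_h ρ_{h'}` over aliased pairs, then `‖f - p‖²_{L²} ≤ 2√s ‖f‖²`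
(`integral_sq_le_of_vanish_lattice`). The penalty adds `λ‖f‖²`. In the smaller space `|⟨f, v⟩_K| ≤
‖f‖ ‖v‖_{L²}`, and the penalty only costs order `λ²`, which explains the faster rate.

Generating vector: averaging over all vectors modulo `N` the aliasing sum of `ρ^q` gives order
`1/N`. By `(Σ a)^q ≤ Σ a^q`, the vector that minimizes the aliasing sum of `ρ` itself inherits this
for all admissible `q` at once, so it does not depend on `δ` or `ε` (`exists_generatingVector`). It
remains to balance `N^{-1/(2q)}`, `λ` or `λ²`, and `M⁻¹ λ^{-τ}` with `q = min(1/(α-4δ), τ)`. -/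

/-! ### Orthogonality of the Fourier modes. -/

/-- The trigonometric monomial `e^{2πi h·x}` on the unit cube. -/
noncomputable def fourierMode {d : ℕ} (h : Fin d → ℤ) (x : UnitCube d) : ℂ :=
  Complex.exp (fourierPhase h fun j => (x j : ℝ))

theorem norm_fourierMode {d : ℕ} (h : Fin d → ℤ) (x : UnitCube d) : ‖fourierMode h x‖ = 1 := by
  simp [fourierMode, fourierPhase, Complex.norm_exp]

theorem fourierMode_add {d : ℕ} (h k : Fin d → ℤ) (x : UnitCube d) :
    fourierMode (h + k) x = fourierMode h x * fourierMode k x := by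
  rw [fourierMode, fourierMode, fourierMode, ← Complex.exp_add]
  congr 1
  simp only [fourierPhase, Pi.add_apply, Int.cast_add, add_mul, Finset.sum_add_distrib]
  push_cast
  ring

theorem fourierMode_neg {d : ℕ} (h : Fin d → ℤ) (x : UnitCube d) :
    fourierMode (-h) x = (starRingEnd ℂ) (fourierMode h x) := by
  rw [fourierMode, fourierMode, ← Complex.exp_conj]
  congr 1
  simp [fourierPhase, Complex.conj_ofNat]

theorem fourierMode_mul_conj {d : ℕ} (h : Fin d → ℤ) (x y : UnitCube d) :
    fourierMode h x * (starRingEnd ℂ) (fourierMode h y) =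
      Complex.exp (fourierPhase h fun j => (x j : ℝ) - (y j : ℝ)) := by
  rw [← fourierMode_neg, fourierMode, fourierMode, ← Complex.exp_add]
  congr 1
  simp only [fourierPhase, Pi.neg_apply, Int.cast_neg, neg_mul, mul_sub, Finset.sum_neg_distrib,
    Finset.sum_sub_distrib]
  push_cast
  ring

theorem continuous_fourierMode {d : ℕ} (h : Fin d → ℤ) :
    Continuous (fourierMode h : UnitCube d → ℂ) := by
  unfold fourierMode fourierPhase
  fun_prop

theorem integral_unitInterval_exp (n : ℤ) :
    ∫ x : unitInterval, Complex.exp (2 * Real.pi * Complex.I * ((n * (x : ℝ) : ℝ) : ℂ)) =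
      if n = 0 then 1 else 0 := by
  rw [show (∫ x : unitInterval, Complex.exp (2 * Real.pi * Complex.I * ((n * (x : ℝ) : ℝ) : ℂ))) =
    ∫ x in (Set.Icc (0:ℝ) 1), Complex.exp (2 * Real.pi * Complex.I * ((n * x : ℝ) : ℂ)) from
    integral_subtype_comap measurableSet_Icc
      (fun x : ℝ => Complex.exp (2 * Real.pi * Complex.I * ((n * x : ℝ) : ℂ)))]
  rw [integral_Icc_eq_integral_Ioc, ← intervalIntegral.integral_of_le zero_le_one]
  split_ifs with hn
  · simp [hn]
  · have hc : (2 * Real.pi * Complex.I * n : ℂ) ≠ 0 := by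
      have : (n : ℂ) ≠ 0 := by exact_mod_cast hn
      simp [Real.pi_ne_zero, this]
    have e : ∀ x : ℝ, (2 * Real.pi * Complex.I * ((n * x : ℝ) : ℂ)) =
        (2 * Real.pi * Complex.I * n) * x := fun x => by push_cast; ring
    simp only [e]
    rw [integral_exp_mul_complex hc]
    have : Complex.exp (2 * Real.pi * Complex.I * n) = 1 := by
      rw [mul_comm]; exact Complex.exp_int_mul_two_pi_mul_I n
    simp [this]

theorem integral_fourierMode {d : ℕ} (h : Fin d → ℤ) :
    ∫ x : UnitCube d, fourierMode h x = if h = 0 then 1 else 0 := by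
  have e : ∀ x : UnitCube d, fourierMode h x =
      ∏ j, Complex.exp (2 * Real.pi * Complex.I * ((h j * (x j : ℝ) : ℝ) : ℂ)) := by
    intro x
    rw [fourierMode, fourierPhase, ← Complex.exp_sum]
    push_cast
    rw [Finset.mul_sum]
  simp only [e]
  rw [integral_fintype_prod_volume_eq_prod (fun j (t : unitInterval) =>
    Complex.exp (2 * Real.pi * Complex.I * ((h j * (t : ℝ) : ℝ) : ℂ)))]
  simp only [integral_unitInterval_exp]
  split_ifs with h0
  · simp [h0]
  · obtain ⟨j, hj⟩ := Function.ne_iff.1 h0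
    exact Finset.prod_eq_zero (Finset.mem_univ j) (by simpa using hj)

/-! ### Parseval's identity for absolutely convergent Fourier series. -/

section Parseval

variable {d : ℕ} {c : (Fin d → ℤ) → ℂ} {F : UnitCube d → ℝ}

theorem continuous_of_hasSum_fourierMode (hc : Summable fun h => ‖c h‖)
    (hF : ∀ x, HasSum (fun h => c h * fourierMode h x) (F x : ℂ)) : Continuous F := by
  have : Continuous fun x => (F x : ℂ) := by
    simp only [fun x => (hF x).tsum_eq.symm]
    refine continuous_tsum (fun h => continuous_const.mul (continuous_fourierMode h)) hc
      fun h x => ?_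
    rw [norm_mul, norm_fourierMode, mul_one]
  exact Complex.continuous_re.comp this

theorem hasSum_integral_mul_of_hasSum_fourierMode (hc : Summable fun h => ‖c h‖)
    (hF : ∀ x, HasSum (fun h => c h * fourierMode h x) (F x : ℂ)) {g : UnitCube d → ℂ}
    (hg : Continuous g) :
    HasSum (fun h => c h * ∫ x, fourierMode h x * g x) (∫ x, (F x : ℂ) * g x) := by
  obtain ⟨C, hC⟩ := (isCompact_range hg).isBounded.exists_norm_le
  have hCx : ∀ x, ‖g x‖ ≤ C := fun x => hC _ ⟨x, rfl⟩
  have hint : ∀ h, Integrable fun x => c h * fourierMode h x * g x := fun h =>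
    ((continuous_const.mul (continuous_fourierMode h)).mul hg).integrable_of_hasCompactSupport
      (HasCompactSupport.of_compactSpace _)
  have key := hasSum_integral_of_summable_integral_norm (μ := volume) hint (by
    refine Summable.of_nonneg_of_le (fun h => integral_nonneg fun x => norm_nonneg _) (fun h => ?_)
      (hc.mul_right C)
    calc ∫ x, ‖c h * fourierMode h x * g x‖ ≤ ∫ _ : UnitCube d, ‖c h‖ * C := by
          refine integral_mono (hint h).norm (integrable_const _) fun x => ?_
          simp only [norm_mul, norm_fourierMode, mul_one]
          exact mul_le_mul_of_nonneg_left (hCx x) (norm_nonneg _)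
      _ = ‖c h‖ * C := by simp)
  have e1 : (fun h => c h * ∫ x, fourierMode h x * g x) =
      fun h => ∫ x, c h * fourierMode h x * g x := by
    funext h
    rw [← integral_const_mul]
    simp only [mul_assoc]
  have e2 : (∫ x, (F x : ℂ) * g x) = ∫ x, ∑' h, c h * fourierMode h x * g x := by
    refine integral_congr_ae (Filter.Eventually.of_forall fun x => ?_)
    exact ((hF x).mul_right (g x)).tsum_eq.symm
  rw [e1, e2]
  exact key

theorem integral_mul_fourierMode_neg (hc : Summable fun h => ‖c h‖)
    (hF : ∀ x, HasSum (fun h => c h * fourierMode h x) (F x : ℂ)) (k : Fin d → ℤ) :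
    ∫ x, (F x : ℂ) * fourierMode (-k) x = c k := by
  refine (hasSum_integral_mul_of_hasSum_fourierMode hc hF (continuous_fourierMode (-k))).unique ?_
  simp only [← fourierMode_add, integral_fourierMode, ← sub_eq_add_neg, sub_eq_zero]
  convert hasSum_ite_eq k (c k) using 2 with h
  by_cases hh : h = k <;> simp [hh]

theorem hasSum_norm_sq_of_hasSum_fourierMode (hc : Summable fun h => ‖c h‖)
    (hF : ∀ x, HasSum (fun h => c h * fourierMode h x) (F x : ℂ)) :
    HasSum (fun h => ‖c h‖ ^ 2) (∫ x, F x ^ 2) := by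
  have hFc : Continuous fun x => (F x : ℂ) :=
    Complex.continuous_ofReal.comp (continuous_of_hasSum_fourierMode hc hF)
  have h1 := hasSum_integral_mul_of_hasSum_fourierMode hc hF hFc
  have h2 : ∀ h, ∫ x, fourierMode h x * (F x : ℂ) = (starRingEnd ℂ) (c h) := by
    intro h
    rw [← integral_mul_fourierMode_neg hc hF h, ← integral_conj]
    refine integral_congr_ae (Filter.Eventually.of_forall fun x => ?_)
    simp [fourierMode_neg, mul_comm]
  have h3 : ∫ x, (F x : ℂ) * (F x : ℂ) = ((∫ x, F x ^ 2 : ℝ) : ℂ) := by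
    rw [← integral_complex_ofReal]
    simp [sq]
  rw [h3] at h1
  have := Complex.hasSum_re h1
  rw [Complex.ofReal_re] at this
  convert this using 2 with h
  rw [h2, Complex.mul_conj, Complex.ofReal_re, Complex.normSq_eq_norm_sq]

end Parseval

/-! ### Feature maps of reproducing kernel Hilbert spaces. -/

section FeatureMap

open InnerProductSpace

/-- A feature map for the kernel of a real reproducing kernel Hilbert space extends to an isometry. -/
theorem RKHS.exists_isometry_of_feature {X H E : Type*} [NormedAddCommGroup H]
    [InnerProductSpace ℝ H] [CompleteSpace H] [RKHS ℝ H X ℝ] [NormedAddCommGroup E]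
    [InnerProductSpace ℝ E] [CompleteSpace E] (Φ : X → E)
    (hΦ : ∀ x y, inner ℝ (Φ x) (Φ y) = RKHS.kerFun H y 1 x) :
    ∃ T : H →ₗᵢ[ℝ] E, ∀ x, T (RKHS.kerFun H x 1) = Φ x := by
  let e : (X →₀ ℝ) →ₗ[ℝ] H := Finsupp.linearCombination ℝ fun x => RKHS.kerFun H x 1
  let f : (X →₀ ℝ) →ₗ[ℝ] E := Finsupp.linearCombination ℝ Φ
  -- Finite combinations of kernel sections are dense, and there the two norms agree because both
  -- are computed from the kernel; the isometry is the extension by continuity.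
  have hdense : DenseRange e := by
    have h := RKHS.kerFun_dense H
    rw [← Submodule.dense_iff_topologicalClosure_eq_top] at h
    refine h.mono ?_
    change _ ⊆ ((LinearMap.range e : Submodule ℝ H) : Set H)
    refine Submodule.span_le.2 ?_
    rintro _ ⟨x, v, rfl⟩
    refine ⟨Finsupp.single x v, ?_⟩
    simp only [e, Finsupp.linearCombination_single]
    rw [← map_smul, smul_eq_mul, mul_one]
  have hnorm : ∀ a, ‖f a‖ = ‖e a‖ := by
    intro a
    rw [← sq_eq_sq₀ (norm_nonneg _) (norm_nonneg _), ← real_inner_self_eq_norm_sq,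
      ← real_inner_self_eq_norm_sq]
    simp only [e, f, Finsupp.linearCombination_apply, Finsupp.sum, sum_inner, inner_sum,
      inner_smul_left, inner_smul_right, hΦ, RKHS.kerFun_inner]
    simp
  have hb : ∃ C, ∀ a, ‖f a‖ ≤ C * ‖e a‖ := ⟨1, fun a => by rw [hnorm, one_mul]⟩
  let T := f.extendOfNorm e
  have hT : ∀ a, T (e a) = f a := f.extendOfNorm_eq hdense hb
  refine ⟨⟨T.toLinearMap, fun w => ?_⟩, fun x => ?_⟩
  · refine hdense.induction_on (p := fun w => ‖T w‖ = ‖w‖) w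
      (isClosed_eq (by fun_prop) (by fun_prop)) fun a => ?_
    rw [hT, hnorm]
  · have := hT (Finsupp.single x 1)
    simpa [e, f] using this

theorem RKHS.clm_eq_zero_of_kerFun {X H F : Type*} [NormedAddCommGroup H]
    [InnerProductSpace ℝ H] [CompleteSpace H] [RKHS ℝ H X ℝ] [NormedAddCommGroup F]
    [NormedSpace ℝ F] (L : H →L[ℝ] F) (hL : ∀ x, L (RKHS.kerFun H x 1) = 0) : L = 0 := by
  have h := RKHS.kerFun_dense H
  rw [← Submodule.dense_iff_topologicalClosure_eq_top] at h
  refine ContinuousLinearMap.ext_on h ?_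
  rintro _ ⟨x, v, rfl⟩
  have : RKHS.kerFun H x v = v • RKHS.kerFun H x 1 := by
    rw [← map_smul, smul_eq_mul, mul_one]
  rw [this, map_smul, hL]
  simp

end FeatureMap

/-! ### Translation-invariant kernels in Fourier coordinates. -/

section FourierIsometry

open RKHS

/-- Square summable families of complex numbers indexed by the frequencies. -/
abbrev FourierSeq (d : ℕ) : Type := lp (fun _ : Fin d → ℤ => ℂ) 2

theorem FourierSeq.hasSum_norm_sq {d : ℕ} (w : FourierSeq d) :
    HasSum (fun h => ‖w h‖ ^ 2) (‖w‖ ^ 2) := by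
  have := lp.hasSum_norm (p := 2) (by norm_num) w
  simpa using this

variable {d : ℕ} {ρ : (Fin d → ℤ) → ℝ≥0}

theorem memℓp_sqrt_mul (hρ : Summable fun h => (ρ h : ℝ)) {a : (Fin d → ℤ) → ℂ}
    (ha : ∀ h, ‖a h‖ ≤ 1) :
    Memℓp (fun h => ((√(ρ h : ℝ) : ℝ) : ℂ) * a h) 2 := by
  refine memℓp_gen ?_
  refine Summable.of_nonneg_of_le (fun h => by positivity) (fun h => ?_) hρ
  have h1 : ‖((√(ρ h : ℝ) : ℝ) : ℂ) * a h‖ ≤ √(ρ h : ℝ) := by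
    rw [norm_mul, Complex.norm_real, Real.norm_of_nonneg (Real.sqrt_nonneg _)]
    exact mul_le_of_le_one_right (Real.sqrt_nonneg _) (ha h)
  have h2 := pow_le_pow_left₀ (norm_nonneg _) h1 2
  rw [Real.sq_sqrt (ρ h).coe_nonneg] at h2
  simpa using h2

theorem hasSum_inner_sqrt_mul (hρ : Summable fun h => (ρ h : ℝ)) {a : (Fin d → ℤ) → ℂ}
    (ha : ∀ h, ‖a h‖ ≤ 1) (w : FourierSeq d) :
    HasSum (fun h => (((√(ρ h : ℝ) : ℝ) : ℂ) * w h * (starRingEnd ℂ) (a h)).re)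
      (inner ℝ (⟨_, memℓp_sqrt_mul hρ ha⟩ : FourierSeq d) w) := by
  have key := lp.hasSum_inner (𝕜 := ℝ) (⟨_, memℓp_sqrt_mul hρ ha⟩ : FourierSeq d) w
  have e : ∀ h, (((√(ρ h : ℝ) : ℝ) : ℂ) * w h * (starRingEnd ℂ) (a h)).re =
      inner ℝ ((⟨_, memℓp_sqrt_mul hρ ha⟩ : FourierSeq d) h) (w h) := by
    intro h
    rw [Complex.inner, map_mul, Complex.conj_ofReal]
    congr 1
    ring
  simp only [e]
  exact key

/-- By `√ρ |w| ≤ ρ + |w|²`; this makes every function of the space an absolutely convergent, hence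
continuous, Fourier series. -/
theorem summable_norm_sqrt_mul (hρ : Summable fun h => (ρ h : ℝ)) (w : FourierSeq d) :
    Summable fun h => ‖((√(ρ h : ℝ) : ℝ) : ℂ) * w h‖ := by
  refine Summable.of_nonneg_of_le (fun h => norm_nonneg _) (fun h => ?_)
    (hρ.add (FourierSeq.hasSum_norm_sq w).summable)
  rw [norm_mul, Complex.norm_real, Real.norm_of_nonneg (Real.sqrt_nonneg _)]
  nlinarith [sq_nonneg (√(ρ h : ℝ) - ‖w h‖), Real.sq_sqrt (ρ h).coe_nonneg,
    mul_nonneg (Real.sqrt_nonneg (ρ h : ℝ)) (norm_nonneg (w h))]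

theorem kerFun_fourierKernelMatrix (x y : UnitCube d) :
    kerFun (OfKernel (fourierKernelMatrix ρ)) y 1 x = fourierKernel ρ x y := by
  rw [kerFun_apply, OfKernel.kernel_ofKernel]
  simp [fourierKernelMatrix]

/-- The reproducing kernel Hilbert space of a translation-invariant kernel, in terms of Fourier
coefficients. -/
theorem exists_fourierIsometry (hρ : Summable fun h => (ρ h : ℝ)) (hev : ∀ h, ρ (-h) = ρ h) :
    ∃ T : OfKernel (fourierKernelMatrix ρ) →ₗᵢ[ℝ] FourierSeq d,
      (∀ f x, HasSum (fun h => ((√(ρ h : ℝ) : ℝ) : ℂ) * T f h * fourierMode h x) (f x : ℂ)) ∧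
      ∀ w : FourierSeq d, ∀ F : UnitCube d → ℝ,
        (∀ x, HasSum (fun h => ((√(ρ h : ℝ) : ℝ) : ℂ) * w h * fourierMode h x) (F x : ℂ)) →
        ∃ u : OfKernel (fourierKernelMatrix ρ), (∀ x, u x = F x) ∧ ‖u‖ ≤ ‖w‖ ∧
          ∀ v, inner ℝ u v = inner ℝ w (T v) := by
  have hmode : ∀ (x : UnitCube d) (h : Fin d → ℤ), ‖(starRingEnd ℂ) (fourierMode h x)‖ ≤ 1 :=
    fun x h => by rw [RCLike.norm_conj, norm_fourierMode]
  have hmodeI : ∀ (x : UnitCube d) (h : Fin d → ℤ),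
      ‖Complex.I * (starRingEnd ℂ) (fourierMode h x)‖ ≤ 1 :=
    fun x h => by rw [norm_mul, RCLike.norm_conj, norm_fourierMode]; simp
  let Φ : UnitCube d → FourierSeq d := fun x => ⟨_, memℓp_sqrt_mul hρ (hmode x)⟩
  -- The real inner product with `Φ x` gives the real part of the Fourier series at `x`, the one
  -- with `Ψ x` its imaginary part. The latter must be shown to vanish on the range of `T`.
  let Ψ : UnitCube d → FourierSeq d := fun x => ⟨_, memℓp_sqrt_mul hρ (hmodeI x)⟩
  have hexp : ∀ (x y : UnitCube d) (h : Fin d → ℤ),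
      ((√(ρ h : ℝ) : ℝ) : ℂ) * (((√(ρ h : ℝ) : ℝ) : ℂ) * (starRingEnd ℂ) (fourierMode h y)) *
        fourierMode h x = ((ρ h : ℝ) : ℂ) *
          Complex.exp (fourierPhase h fun j => (x j : ℝ) - (y j : ℝ)) := by
    intro x y h
    rw [← fourierMode_mul_conj]
    have : ((√(ρ h : ℝ) : ℝ) : ℂ) * ((√(ρ h : ℝ) : ℝ) : ℂ) = ((ρ h : ℝ) : ℂ) := by
      rw [← Complex.ofReal_mul, Real.mul_self_sqrt (ρ h).coe_nonneg]
    rw [← this]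
    ring
  have hΦ : ∀ x y, inner ℝ (Φ x) (Φ y) =
      kerFun (OfKernel (fourierKernelMatrix ρ)) y 1 x := by
    intro x y
    rw [kerFun_fourierKernelMatrix]
    refine (hasSum_inner_sqrt_mul hρ (hmode x) (Φ y)).unique ?_
    convert fourierKernel_hasSum hρ x y using 2 with h
    rw [Complex.conj_conj, hexp, Complex.re_ofReal_mul]
    simp only [fourierPhase, Complex.exp_re]
    simp
  obtain ⟨T, hT⟩ := RKHS.exists_isometry_of_feature Φ hΦ
  have hre : ∀ f x, inner ℝ (Φ x) (T f) = f x := by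
    intro f x
    rw [← hT, T.inner_map_map, kerFun_inner]
    simp
  have him : ∀ f x, inner ℝ (Ψ x) (T f) = 0 := by
    intro f x
    have : (innerSL ℝ (Ψ x)).comp T.toContinuousLinearMap = 0 := by
      refine RKHS.clm_eq_zero_of_kerFun _ fun y => ?_
      simp only [ContinuousLinearMap.comp_apply, LinearIsometry.coe_toContinuousLinearMap, hT,
        innerSL_apply_apply]
      have h1 := hasSum_inner_sqrt_mul hρ (hmodeI x) (Φ y)
      have e : ∀ h, (((√(ρ h : ℝ) : ℝ) : ℂ) * Φ y h *
          (starRingEnd ℂ) (Complex.I * (starRingEnd ℂ) (fourierMode h x))).re =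
          (ρ h : ℝ) * Real.sin (2 * Real.pi * ∑ j, (h j : ℝ) * ((x j : ℝ) - (y j : ℝ))) := by
        intro h
        have := hexp x y h
        rw [map_mul, Complex.conj_conj, Complex.conj_I, mul_left_comm, neg_mul, Complex.neg_re]
        change -(Complex.I * (((√(ρ h : ℝ) : ℝ) : ℂ) * (((√(ρ h : ℝ) : ℝ) : ℂ) *
          (starRingEnd ℂ) (fourierMode h y)) * fourierMode h x)).re = _
        rw [this, Complex.I_mul_re, neg_neg, Complex.im_ofReal_mul]
        simp only [fourierPhase, Complex.exp_im]
        simp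
      simp only [e] at h1
      -- Since `ρ` is even, `h ↦ -h` turns the sine series into its negative, so its sum is zero.
      have h2 := (Equiv.neg (Fin d → ℤ)).hasSum_iff.2 h1
      have h3 : ∀ h : Fin d → ℤ, ((fun h : Fin d → ℤ => (ρ h : ℝ) * Real.sin (2 * Real.pi *
          ∑ j, (h j : ℝ) * ((x j : ℝ) - (y j : ℝ)))) ∘ Equiv.neg (Fin d → ℤ)) h =
          -((ρ h : ℝ) * Real.sin (2 * Real.pi *
          ∑ j, (h j : ℝ) * ((x j : ℝ) - (y j : ℝ)))) := by
        intro h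
        simp only [Function.comp_apply, Equiv.neg_apply, hev, Pi.neg_apply, Int.cast_neg, neg_mul,
          Finset.sum_neg_distrib, mul_neg, Real.sin_neg]
      rw [funext h3] at h2
      have h4 := h2.unique h1.neg
      change inner ℝ (Ψ x) (Φ y) = 0
      change inner ℝ (Ψ x) (Φ y) = - inner ℝ (Ψ x) (Φ y) at h4
      linarith
    exact DFunLike.congr_fun this f
  have hrec : ∀ (w : FourierSeq d) (x : UnitCube d),
      HasSum (fun h => ((√(ρ h : ℝ) : ℝ) : ℂ) * w h * fourierMode h x)
        ((inner ℝ (Φ x) w : ℝ) + (inner ℝ (Ψ x) w : ℝ) * Complex.I) := by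
    intro w x
    have h1 := hasSum_inner_sqrt_mul hρ (hmode x) w
    have h2 := hasSum_inner_sqrt_mul hρ (hmodeI x) w
    have h3 : HasSum (fun h => ((((√(ρ h : ℝ) : ℝ) : ℂ) * w h *
        (starRingEnd ℂ) ((starRingEnd ℂ) (fourierMode h x))).re : ℂ)) (inner ℝ (Φ x) w : ℝ) := by
      exact_mod_cast h1
    have h4 : HasSum (fun h => ((((√(ρ h : ℝ) : ℝ) : ℂ) * w h *
        (starRingEnd ℂ) (Complex.I * (starRingEnd ℂ) (fourierMode h x))).re : ℂ))
        (inner ℝ (Ψ x) w : ℝ) := by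
      exact_mod_cast h2
    convert h3.add (h4.mul_right Complex.I) using 2 with h
    rw [map_mul, Complex.conj_conj, Complex.conj_I, mul_left_comm, neg_mul, Complex.neg_re,
      Complex.I_mul_re, neg_neg, Complex.re_add_im]
  refine ⟨T, fun f x => ?_, fun w F hF => ?_⟩
  · have := hrec (T f) x
    rwa [hre, him, Complex.ofReal_zero, zero_mul, add_zero] at this
  -- No membership of `w` in the range of `T` is required: the adjoint supplies a preimage of the
  -- function, and pairing with `T` of a kernel section recovers its values.
  · let u := ContinuousLinearMap.adjoint T.toContinuousLinearMap w
    have hu : ∀ v, inner ℝ u v = inner ℝ w (T v) := fun v =>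
      ContinuousLinearMap.adjoint_inner_left _ _ _
    refine ⟨u, fun x => ?_, ?_, hu⟩
    · have h1 := hu (kerFun _ x 1)
      rw [inner_kerFun, hT, real_inner_comm] at h1
      have h2 := congrArg Complex.re ((hF x).unique (hrec w x))
      simp at h1 h2
      rw [h1, h2, real_inner_comm]
    · have h1 := hu u
      rw [real_inner_self_eq_norm_sq] at h1
      have h2 := real_inner_le_norm w (T u)
      rw [T.norm_map] at h2
      by_contra! hlt
      nlinarith [norm_nonneg w]

end FourierIsometry

/-! ### Cauchy–Schwarz for series. -/

theorem HasSum.of_eq {ι E : Type*} [AddCommMonoid E] [TopologicalSpace E] {f g : ι → E} {a : E}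
    (hf : HasSum f a) (h : ∀ i, g i = f i) : HasSum g a :=
  (funext h : g = f) ▸ hf

theorem tsum_mul_sq_le_of_hasSum_sq {ι : Type*} {a b : ι → ℝ} {A B : ℝ} (ha : ∀ i, 0 ≤ a i)
    (hb : ∀ i, 0 ≤ b i) (hA : HasSum (fun i => a i ^ 2) A) (hB : HasSum (fun i => b i ^ 2) B) :
    Summable (fun i => a i * b i) ∧ (∑' i, a i * b i) ^ 2 ≤ A * B := by
  have hs : Summable fun i => a i * b i :=
    Summable.of_nonneg_of_le (fun i => mul_nonneg (ha i) (hb i))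
      (fun i => by nlinarith [sq_nonneg (a i - b i), sq_nonneg (a i), sq_nonneg (b i)])
      (hA.summable.add hB.summable)
  have hA0 : 0 ≤ A := hA.nonneg fun i => sq_nonneg _
  have hB0 : 0 ≤ B := hB.nonneg fun i => sq_nonneg _
  refine ⟨hs, ?_⟩
  have h0 : 0 ≤ ∑' i, a i * b i := tsum_nonneg fun i => mul_nonneg (ha i) (hb i)
  rw [← Real.sqrt_le_sqrt_iff (mul_nonneg hA0 hB0), Real.sqrt_sq h0]
  refine hs.tsum_le_of_sum_le fun s => Real.le_sqrt_of_sq_le ?_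
  refine (Finset.sum_mul_sq_le_sq_mul_sq s a b).trans ?_
  exact mul_le_mul (sum_le_hasSum s (fun i _ => sq_nonneg _) hA)
    (sum_le_hasSum s (fun i _ => sq_nonneg _) hB) (Finset.sum_nonneg fun i _ => sq_nonneg _) hA0

/-! ### Aliasing of frequencies on a rank-1 lattice. -/

section Aliasing

variable {d : ℕ}

/-- Two different frequencies agree on the lattice points of the generating vector `z`. -/
def Aliased (N : ℕ) (z : Fin d → ℕ) (h h' : Fin d → ℤ) : Prop :=
  h ≠ h' ∧ (N : ℤ) ∣ ∑ j, (h' j - h j) * (z j : ℤ)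

open Classical in
/-- The sum of `b h * b h'` over all pairs of aliased frequencies. -/
noncomputable def aliasingSum (b : (Fin d → ℤ) → ℝ≥0∞) (N : ℕ) (z : Fin d → ℕ) : ℝ≥0∞ :=
  ∑' h, ∑' h', if Aliased N z h h' then b h * b h' else 0

theorem fourierMode_latticePoint (N : ℕ) (z : Fin d → ℕ) (k : ℕ) (h : Fin d → ℤ) :
    fourierMode h (latticePoint N z k) =
      (Complex.exp (2 * Real.pi * Complex.I / N) ^ (∑ j, h j * (z j : ℤ))) ^ k := by
  rw [← Complex.exp_int_mul, ← Complex.exp_nat_mul, fourierMode, fourierPhase,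
    Complex.exp_eq_exp_iff_exists_int]
  -- Passing to fractional parts changes the phase by an integer multiple of `2πi`.
  refine ⟨-∑ j, h j * ⌊(k : ℝ) * (z j : ℝ) / (N : ℝ)⌋, ?_⟩
  have : (∑ j, (h j : ℝ) * ((latticePoint N z k j : unitInterval) : ℝ)) =
      (k : ℝ) * (∑ j, (h j : ℝ) * (z j : ℝ)) / N -
        ∑ j, (h j : ℝ) * (⌊(k : ℝ) * (z j : ℝ) / (N : ℝ)⌋ : ℝ) := by
    rw [Finset.mul_sum, Finset.sum_div, ← Finset.sum_sub_distrib]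
    refine Finset.sum_congr rfl fun j _ => ?_
    simp only [latticePoint, Int.fract]
    ring
  rw [this]
  push_cast
  ring

theorem sum_rootOfUnity_zpow_pow {N : ℕ} (hN : N ≠ 0) (m : ℤ) :
    ∑ k ∈ Finset.Icc 1 N, (Complex.exp (2 * Real.pi * Complex.I / N) ^ m) ^ k =
      if (N : ℤ) ∣ m then (N : ℂ) else 0 := by
  have hp := Complex.isPrimitiveRoot_exp N hN
  set η := Complex.exp (2 * Real.pi * Complex.I / N) ^ m with hη
  split_ifs with hm
  · have : η = 1 := (hp.zpow_eq_one_iff_dvd m).2 hm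
    simp [this]
  · have h1 : η ≠ 1 := fun h => hm ((hp.zpow_eq_one_iff_dvd m).1 h)
    have hN1 : η ^ N = 1 := by
      rw [hη, ← zpow_natCast, zpow_comm, zpow_natCast, hp.pow_eq_one, one_zpow]
    have h2 : ∑ k ∈ Finset.Icc 1 N, η ^ k = η * ∑ k ∈ Finset.range N, η ^ k := by
      rw [Finset.mul_sum, Finset.range_eq_Ico, ← Finset.Ico_add_one_right_eq_Icc,
        Finset.sum_Ico_add' (fun k => η ^ k) 0 N 1 |>.symm]
      exact Finset.sum_congr rfl fun k _ => by rw [pow_succ']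
    rw [h2, geom_sum_eq h1, hN1]
    simp

open Classical in
/-- The Fourier coefficients of a function that vanishes on the lattice sum to zero over each
aliasing class. -/
theorem hasSum_aliased_of_vanish {N : ℕ} (hN : N ≠ 0) {z : Fin d → ℕ} {c : (Fin d → ℤ) → ℂ}
    {F : UnitCube d → ℝ} (hF : ∀ x, HasSum (fun h => c h * fourierMode h x) (F x : ℂ))
    (h0 : ∀ k ∈ Finset.Icc 1 N, F (latticePoint N z k) = 0) (h : Fin d → ℤ) :
    HasSum (fun h' => if Aliased N z h h' then c h' else 0) (-c h) := by
  -- Pair `F` with the mode `-h` over the lattice: the values of `F` make the total zero, while the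
  -- character sum keeps exactly the frequencies that agree with `h` on the lattice.
  have h1 : HasSum (fun h' => ∑ k ∈ Finset.Icc 1 N, c h' *
      fourierMode h' (latticePoint N z k) * fourierMode (-h) (latticePoint N z k)) 0 := by
    have := hasSum_sum (f := fun k h' => c h' * fourierMode h' (latticePoint N z k) *
      fourierMode (-h) (latticePoint N z k)) (s := Finset.Icc 1 N) fun k _ =>
        (hF (latticePoint N z k)).mul_right (fourierMode (-h) (latticePoint N z k))
    rwa [Finset.sum_eq_zero fun k hk => by rw [h0 k hk, Complex.ofReal_zero, zero_mul]] at this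
  have hNc : (N : ℂ) ≠ 0 := by exact_mod_cast hN
  have e : ∀ h', ∑ k ∈ Finset.Icc 1 N, c h' *
      fourierMode h' (latticePoint N z k) * fourierMode (-h) (latticePoint N z k) =
      if (N : ℤ) ∣ ∑ j, (h' j - h j) * (z j : ℤ) then (N : ℂ) * c h' else 0 := by
    intro h'
    have e1 : ∀ k, c h' * fourierMode h' (latticePoint N z k) *
        fourierMode (-h) (latticePoint N z k) = c h' *
        (Complex.exp (2 * Real.pi * Complex.I / N) ^ (∑ j, (h' + -h) j * (z j : ℤ))) ^ k :=
      fun k => by rw [mul_assoc, ← fourierMode_add, fourierMode_latticePoint]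
    simp only [e1]
    rw [← Finset.mul_sum, sum_rootOfUnity_zpow_pow hN]
    simp only [Pi.add_apply, Pi.neg_apply, ← sub_eq_add_neg]
    split_ifs <;> ring
  simp only [e] at h1
  -- The class contains `h` itself, which `Aliased` excludes; removing this term produces `-c h`.
  have h2 := (h1.mul_left (N : ℂ)⁻¹).sub (hasSum_ite_eq h (c h))
  rw [mul_zero, zero_sub] at h2
  refine h2.of_eq fun h' => ?_
  by_cases hh : h' = h
  · subst hh
    simp [Aliased, hNc]
  · simp only [Aliased, ne_eq, Ne.symm hh, not_false_eq_true, true_and, hh, if_false, sub_zero]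
    split_ifs
    · field_simp
    · simp

end Aliasing

/-! ### `L²` size of functions vanishing on the lattice. -/

section LatticeApproximation

open RKHS

variable {d : ℕ} {ρ : (Fin d → ℤ) → ℝ≥0}

theorem hasSum_integral_sq_of_isometry {w : FourierSeq d} {F : UnitCube d → ℝ}
    (hρ : Summable fun h => (ρ h : ℝ))
    (hF : ∀ x, HasSum (fun h => ((√(ρ h : ℝ) : ℝ) : ℂ) * w h * fourierMode h x) (F x : ℂ)) :
    HasSum (fun h => (ρ h : ℝ) * ‖w h‖ ^ 2) (∫ x, F x ^ 2) := by
  convert hasSum_norm_sq_of_hasSum_fourierMode (summable_norm_sqrt_mul hρ w) hF using 2 with h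
  rw [norm_mul, Complex.norm_real, Real.norm_of_nonneg (Real.sqrt_nonneg _), mul_pow,
    Real.sq_sqrt (ρ h).coe_nonneg]

open Classical in
/-- A function of the space that vanishes on the lattice is small in `L²`. -/
theorem integral_sq_le_of_vanish_lattice (hρ : Summable fun h => (ρ h : ℝ)) {N : ℕ} (hN : N ≠ 0)
    {z : Fin d → ℕ} {s : ℝ} (hs : 0 < s)
    (hS : aliasingSum (fun h => (ρ h : ℝ≥0∞)) N z ≤ ENNReal.ofReal s) {w : FourierSeq d}
    {F : UnitCube d → ℝ}
    (hF : ∀ x, HasSum (fun h => ((√(ρ h : ℝ) : ℝ) : ℂ) * w h * fourierMode h x) (F x : ℂ))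
    (h0 : ∀ k ∈ Finset.Icc 1 N, F (latticePoint N z k) = 0) :
    ∫ x, F x ^ 2 ≤ 2 * √s * ‖w‖ ^ 2 := by
  have hite : ∀ h, Summable fun h' => if Aliased N z h h' then (ρ h' : ℝ) else 0 := fun h =>
    Summable.of_nonneg_of_le (fun h' => by split_ifs <;> simp) (fun h' => by split_ifs <;> simp) hρ
  set R : (Fin d → ℤ) → ℝ := fun h => ∑' h', if Aliased N z h h' then (ρ h' : ℝ) else 0 with hR
  have hR0 : ∀ h, 0 ≤ R h := fun h => tsum_nonneg fun h' => by split_ifs <;> simp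
  have hRle : ∀ h, R h ≤ ∑' h', (ρ h' : ℝ) := fun h =>
    (hite h).tsum_le_tsum (fun h' => by split_ifs <;> simp) hρ
  have hρR : Summable fun h => (ρ h : ℝ) * R h :=
    Summable.of_nonneg_of_le (fun h => mul_nonneg (ρ h).coe_nonneg (hR0 h))
      (fun h => mul_le_mul_of_nonneg_left (hRle h) (ρ h).coe_nonneg) (hρ.mul_right _)
  have hsum : ∑' h, (ρ h : ℝ) * R h ≤ s := by
    rw [← ENNReal.ofReal_le_ofReal_iff hs.le]
    refine le_trans (le_of_eq ?_) hS
    rw [ENNReal.ofReal_tsum_of_nonneg (fun h => mul_nonneg (ρ h).coe_nonneg (hR0 h)) hρR]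
    refine tsum_congr fun h => ?_
    rw [ENNReal.ofReal_mul (ρ h).coe_nonneg, hR,
      ENNReal.ofReal_tsum_of_nonneg (fun h' => by split_ifs <;> simp) (hite h),
      ← ENNReal.tsum_mul_left]
    refine tsum_congr fun h' => ?_
    split_ifs <;> simp
  -- Each coefficient is minus the sum of the coefficients aliased to it; apply Cauchy–Schwarz to
  -- `√ρ · ‖w‖` over that class.
  have hcoef : ∀ h, (ρ h : ℝ) * ‖w h‖ ^ 2 ≤ R h * ‖w‖ ^ 2 := by
    intro h
    have h1 := hasSum_aliased_of_vanish hN hF h0 h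
    have hA : HasSum (fun h' => (if Aliased N z h h' then √(ρ h' : ℝ) else 0) ^ 2) (R h) := by
      convert (hite h).hasSum using 2 with h'
      split_ifs
      · exact Real.sq_sqrt (ρ h').coe_nonneg
      · simp
    obtain ⟨h2, h3⟩ := tsum_mul_sq_le_of_hasSum_sq
      (fun h' => by split_ifs; exacts [Real.sqrt_nonneg _, le_rfl]) (fun h' => norm_nonneg (w h'))
      hA (FourierSeq.hasSum_norm_sq w)
    have h4 : ∀ h', ‖if Aliased N z h h' then ((√(ρ h' : ℝ) : ℝ) : ℂ) * w h' else 0‖ =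
        (if Aliased N z h h' then √(ρ h' : ℝ) else 0) * ‖w h'‖ := by
      intro h'
      split_ifs
      · rw [norm_mul, Complex.norm_real, Real.norm_of_nonneg (Real.sqrt_nonneg _)]
      · simp
    have h5 : ‖((√(ρ h : ℝ) : ℝ) : ℂ) * w h‖ ≤
        ∑' h', (if Aliased N z h h' then √(ρ h' : ℝ) else 0) * ‖w h'‖ := by
      rw [← norm_neg, ← h1.tsum_eq, ← tsum_congr h4]
      exact norm_tsum_le_tsum_norm (by simpa only [h4] using h2)
    have h6 := (pow_le_pow_left₀ (norm_nonneg _) h5 2).trans h3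
    rwa [norm_mul, Complex.norm_real, Real.norm_of_nonneg (Real.sqrt_nonneg _), mul_pow,
      Real.sq_sqrt (ρ h).coe_nonneg] at h6
  have ht : 0 < √s := Real.sqrt_pos.2 hs
  -- The threshold `√s` separates the frequencies. Below it `ρ h ≤ √s` suffices; above it `1 ≤ ρ h /
  -- √s` is inserted into `hcoef`. As `ρ h * R h` sums to at most `s`, both parts contribute `√s
  -- ‖w‖²`.
  have hsplit : ∀ h, (ρ h : ℝ) * ‖w h‖ ^ 2 ≤
      √s * ‖w h‖ ^ 2 + (√s)⁻¹ * ‖w‖ ^ 2 * ((ρ h : ℝ) * R h) := by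
    intro h
    have hpos : 0 ≤ (√s)⁻¹ * ‖w‖ ^ 2 * ((ρ h : ℝ) * R h) :=
      mul_nonneg (by positivity) (mul_nonneg (ρ h).coe_nonneg (hR0 h))
    rcases le_total (ρ h : ℝ) (√s) with hle | hle
    · nlinarith [mul_le_mul_of_nonneg_right hle (sq_nonneg ‖w h‖)]
    · have h1 : 1 ≤ (√s)⁻¹ * ρ h := by
        rw [inv_mul_eq_div, one_le_div ht]
        exact hle
      have h2 := mul_le_mul_of_nonneg_right h1 (mul_nonneg (hR0 h) (sq_nonneg ‖w‖))
      nlinarith [hcoef h, mul_nonneg ht.le (sq_nonneg ‖w h‖)]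
  have hl := hasSum_integral_sq_of_isometry hρ hF
  have hr := ((FourierSeq.hasSum_norm_sq w).mul_left (√s)).add
    (hρR.hasSum.mul_left ((√s)⁻¹ * ‖w‖ ^ 2))
  refine (hasSum_le hsplit hl hr).trans ?_
  have h7 : (√s)⁻¹ * ‖w‖ ^ 2 * ∑' h, (ρ h : ℝ) * R h ≤ (√s)⁻¹ * ‖w‖ ^ 2 * s :=
    mul_le_mul_of_nonneg_left hsum (by positivity)
  have h8 : (√s)⁻¹ * ‖w‖ ^ 2 * s = √s * ‖w‖ ^ 2 := by
    nth_rewrite 2 [← Real.mul_self_sqrt hs.le]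
    field_simp
  linarith

end LatticeApproximation

/-! ### Point evaluation in the penalized norm. -/

section PointEvaluation

variable {d : ℕ} {ρ : (Fin d → ℤ) → ℝ≥0}

/-- This is `t ≤ t^τ (t + 1)` for `t = r / lam`: the summand `1` suffices if `t ≤ 1`, the summand
`t` if `t ≥ 1`. -/
theorem le_rpow_mul_add {r lam τ : ℝ} (hr : 0 ≤ r) (hlam : 0 < lam) (hτ0 : 0 ≤ τ) (hτ1 : τ ≤ 1) :
    r ≤ lam ^ (-τ) * r ^ τ * (r + lam) := by
  have e : lam ^ (-τ) * r ^ τ = (r / lam) ^ τ := by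
    rw [Real.div_rpow hr hlam.le, Real.rpow_neg hlam.le, div_eq_inv_mul]
  rw [e]
  have hq : 0 ≤ r / lam := by positivity
  rcases le_total (r / lam) 1 with h | h
  · have h1 : r / lam ≤ (r / lam) ^ τ := by
      simpa using Real.rpow_le_rpow_of_exponent_ge_of_imp hq h hτ1 (by intro h1 h2; simp at h2)
    have h2 : r / lam * lam = r := by field_simp
    nlinarith [mul_le_mul_of_nonneg_right h1 hlam.le, Real.rpow_nonneg hq τ,
      mul_nonneg (Real.rpow_nonneg hq τ) hr]
  · have h1 : 1 ≤ (r / lam) ^ τ := Real.one_le_rpow h hτ0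
    nlinarith [mul_le_mul_of_nonneg_right h1 hr, mul_nonneg (Real.rpow_nonneg hq τ) hlam.le]

/-- In Fourier coordinates the penalized norm has weights `ρ_h + lam`. Distributing `√ρ_h ≤
√(lam^{-τ} ρ_h^τ) √(ρ_h + lam)` over the two factors of Cauchy–Schwarz gives the bound; smaller `τ`
means a weaker blow-up as `lam → 0`, at the price of a heavier sum. -/
theorem sq_apply_le (hρ : Summable fun h => (ρ h : ℝ)) {lam τ W : ℝ} (hlam : 0 < lam)
    (hτ0 : 0 ≤ τ) (hτ1 : τ ≤ 1) (hW : HasSum (fun h => (ρ h : ℝ) ^ τ) W) {w : FourierSeq d}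
    {F : UnitCube d → ℝ}
    (hF : ∀ x, HasSum (fun h => ((√(ρ h : ℝ) : ℝ) : ℂ) * w h * fourierMode h x) (F x : ℂ))
    (y : UnitCube d) :
    F y ^ 2 ≤ lam ^ (-τ) * W * ((∫ x, F x ^ 2) + lam * ‖w‖ ^ 2) := by
  have hA : HasSum (fun h => √(lam ^ (-τ) * (ρ h : ℝ) ^ τ) ^ 2) (lam ^ (-τ) * W) := by
    refine (hW.mul_left (lam ^ (-τ))).of_eq fun h => ?_
    exact Real.sq_sqrt (by positivity)
  have hB : HasSum (fun h => (√((ρ h : ℝ) + lam) * ‖w h‖) ^ 2)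
      ((∫ x, F x ^ 2) + lam * ‖w‖ ^ 2) := by
    convert (hasSum_integral_sq_of_isometry hρ hF).add
      ((FourierSeq.hasSum_norm_sq w).mul_left lam) using 2 with h
    rw [mul_pow, Real.sq_sqrt (by positivity)]
    ring
  obtain ⟨h1, h2⟩ := tsum_mul_sq_le_of_hasSum_sq (fun h => Real.sqrt_nonneg _)
    (fun h => by positivity) hA hB
  refine le_trans ?_ h2
  rw [← sq_abs]
  refine pow_le_pow_left₀ (abs_nonneg _) ?_ 2
  have h3 : |F y| = ‖(F y : ℂ)‖ := by rw [Complex.norm_real, Real.norm_eq_abs]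
  have hs : Summable fun h => ‖((√(ρ h : ℝ) : ℝ) : ℂ) * w h * fourierMode h y‖ := by
    simpa only [norm_mul, norm_fourierMode, mul_one] using summable_norm_sqrt_mul hρ w
  rw [h3, ← (hF y).tsum_eq]
  refine (norm_tsum_le_tsum_norm hs).trans (hs.tsum_le_tsum (fun h => ?_) h1)
  rw [norm_mul, norm_mul, norm_fourierMode, mul_one, Complex.norm_real,
    Real.norm_of_nonneg (Real.sqrt_nonneg _), ← mul_assoc]
  refine mul_le_mul_of_nonneg_right ?_ (norm_nonneg _)
  rw [← Real.sqrt_mul (by positivity)]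
  exact Real.sqrt_le_sqrt (le_rpow_mul_add (ρ h).coe_nonneg hlam hτ0 hτ1)

end PointEvaluation

/-! ### Penalized least squares in a Hilbert space. -/

section PenalizedProjection

variable {H E : Type*} [NormedAddCommGroup H] [InnerProductSpace ℝ H]
  [NormedAddCommGroup E] [InnerProductSpace ℝ E]

/-- The form `⟨L u, L v⟩ + lam ⟨u, v⟩`. -/
noncomputable def penalizedForm (L : H →ₗ[ℝ] E) (lam : ℝ) : H →ₗ[ℝ] H →ₗ[ℝ] ℝ :=
  (innerₗ E).compl₁₂ L L + lam • innerₗ H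

theorem penalizedForm_apply (L : H →ₗ[ℝ] E) (lam : ℝ) (u v : H) :
    penalizedForm L lam u v = inner ℝ (L u) (L v) + lam * inner ℝ u v := by
  simp [penalizedForm]

/-- For `lam > 0` the form is positive definite on `V`, so an orthogonal basis exists and can be
normalized. -/
theorem exists_orthonormal_penalizedForm (L : H →ₗ[ℝ] E) {lam : ℝ} (hlam : 0 < lam)
    (V : Submodule ℝ H) [FiniteDimensional ℝ V] :
    ∃ (n : ℕ) (φ : Fin n → H), (∀ i, φ i ∈ V) ∧
      (∀ i j, penalizedForm L lam (φ i) (φ j) = if i = j then 1 else 0) ∧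
      ∀ v ∈ V, v = ∑ i, penalizedForm L lam v (φ i) • φ i := by
  let B : LinearMap.BilinForm ℝ V := (penalizedForm L lam).domRestrict₁₂ V V
  have hB : ∀ u v : V, B u v = penalizedForm L lam u v := fun _ _ => rfl
  have hsymm : LinearMap.IsSymm B := ⟨fun u v => by
    simp [hB, penalizedForm_apply, real_inner_comm]⟩
  have hpos : ∀ u : V, u ≠ 0 → 0 < B u u := by
    intro u hu
    rw [hB, penalizedForm_apply]
    have h1 : 0 < inner ℝ (u : H) u :=
      real_inner_self_pos.2 (by simpa using hu)
    have h2 : 0 ≤ inner ℝ (L u) (L u) := real_inner_self_nonneg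
    positivity
  obtain ⟨b, hb⟩ := LinearMap.BilinForm.exists_orthogonal_basis hsymm
  have hbpos : ∀ i, 0 < B (b i) (b i) := fun i => hpos _ (b.ne_zero i)
  let ψ : Fin (Module.finrank ℝ V) → V := fun i => (√(B (b i) (b i)))⁻¹ • b i
  have hψ : ∀ i j, B (ψ i) (ψ j) = if i = j then 1 else 0 := by
    intro i j
    simp only [ψ, map_smul, LinearMap.smul_apply, smul_eq_mul]
    split_ifs with hij
    · subst hij
      have := Real.sq_sqrt (hbpos i).le
      have h0 : √(B (b i) (b i)) ≠ 0 := (Real.sqrt_pos.2 (hbpos i)).ne'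
      field_simp
      exact this.symm
    · rw [show B (b i) (b j) = 0 from hb hij]
      simp
  refine ⟨_, fun i => ψ i, fun i => (ψ i).2, hψ, fun v hv => ?_⟩
  have hrep : (⟨v, hv⟩ : V) = ∑ i, (b.repr ⟨v, hv⟩ i * √(B (b i) (b i))) • ψ i := by
    conv_lhs => rw [← b.sum_repr ⟨v, hv⟩]
    refine Finset.sum_congr rfl fun i _ => ?_
    have h0 : √(B (b i) (b i)) ≠ 0 := (Real.sqrt_pos.2 (hbpos i)).ne'
    simp only [ψ, smul_smul]
    congr 1
    field_simp
  have hcoef : ∀ j, B ⟨v, hv⟩ (ψ j) = b.repr ⟨v, hv⟩ j * √(B (b j) (b j)) := by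
    intro j
    conv_lhs => rw [hrep]
    simp only [map_sum, map_smul, LinearMap.sum_apply, LinearMap.smul_apply, hψ, smul_eq_mul]
    simp
  have h1 := congrArg (Subtype.val) hrep
  simp only [← hcoef, AddSubmonoidClass.coe_finsetSum] at h1
  exact h1

/-- The normal equations make `g` the minimizer over `V` of `‖L (v - f)‖² + lam ‖v‖²`, here compared
with `p`. Testing with `g - p`, the right side minus the left equals `‖L (g - p)‖² + lam ‖g - p‖² +
lam ‖g‖²`. -/
theorem norm_sq_penalized_le {L : H →ₗ[ℝ] E} {lam : ℝ} (hlam : 0 < lam) {V : Submodule ℝ H}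
    {f g p : H} (hg : g ∈ V) (hp : p ∈ V)
    (hgf : ∀ v ∈ V, penalizedForm L lam g v = inner ℝ (L f) (L v)) :
    ‖L (g - f)‖ ^ 2 ≤ ‖L (f - p)‖ ^ 2 + lam * ‖p‖ ^ 2 := by
  have h := hgf (g - p) (V.sub_mem hg hp)
  rw [penalizedForm_apply] at h
  have h1 : ‖L (g - p)‖ ^ 2 ≥ 0 := sq_nonneg _
  have h2 : lam * ‖g - p‖ ^ 2 ≥ 0 := by positivity
  have h3 : lam * ‖g‖ ^ 2 ≥ 0 := by positivity
  simp only [map_sub, ← real_inner_self_eq_norm_sq, inner_sub_left, inner_sub_right,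
    mul_sub] at h h1 h2 h3 ⊢
  rw [real_inner_comm (L p) (L g), real_inner_comm p g] at *
  rw [real_inner_comm (L f) (L g), real_inner_comm (L f) (L p)] at *
  linarith

/-- If `⟨f, ·⟩` is bounded in the weaker norm `‖L ·‖`, the penalty acts as a perturbation of size
`lam * A`, so the squared error costs `lam²`. Orthogonality of `f - p` to `V` replaces `⟨p, g - p⟩`
by `⟨f, g - p⟩`, to which that bound applies. -/
theorem norm_penalized_le {L : H →ₗ[ℝ] E} {lam A : ℝ} (hlam : 0 < lam) (hA0 : 0 ≤ A)
    {V : Submodule ℝ H} {f g p : H} (hg : g ∈ V) (hp : p ∈ V)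
    (hgf : ∀ v ∈ V, penalizedForm L lam g v = inner ℝ (L f) (L v))
    (hfp : ∀ v ∈ V, inner ℝ (f - p) v = 0) (hA : ∀ v ∈ V, |inner ℝ f v| ≤ A * ‖L v‖) :
    ‖L (g - f)‖ ≤ 2 * ‖L (f - p)‖ + lam * A := by
  have hV := V.sub_mem hg hp
  have h := hgf (g - p) hV
  have h1 := hfp (g - p) hV
  have h2 := (neg_le_abs _).trans (hA (g - p) hV)
  have h3 := real_inner_le_norm (L (f - p)) (L (g - p))
  have h4 : ‖L (g - p)‖ ^ 2 + lam * ‖g - p‖ ^ 2 =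
      inner ℝ (L (f - p)) (L (g - p)) - lam * inner ℝ f (g - p) := by
    rw [penalizedForm_apply] at h
    rw [← real_inner_self_eq_norm_sq, ← real_inner_self_eq_norm_sq]
    have e1 : inner ℝ (L (g - p)) (L (g - p)) =
        inner ℝ (L g) (L (g - p)) - inner ℝ (L p) (L (g - p)) := by
      rw [map_sub, inner_sub_left]
    have e2 : inner ℝ (g - p) (g - p) = inner ℝ g (g - p) - inner ℝ p (g - p) := by
      rw [inner_sub_left]
    have e3 : inner ℝ (L (f - p)) (L (g - p)) =
        inner ℝ (L f) (L (g - p)) - inner ℝ (L p) (L (g - p)) := by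
      rw [map_sub L f p, inner_sub_left]
    have e4 : inner ℝ (f - p) (g - p) = inner ℝ f (g - p) - inner ℝ p (g - p) := by
      rw [inner_sub_left]
    rw [e1, e2, e3]
    linear_combination h + lam * h1 - lam * e4
  have h5 : ‖L (g - p)‖ ≤ ‖L (f - p)‖ + lam * A := by
    have h6 : 0 ≤ lam * ‖g - p‖ ^ 2 := by positivity
    have h7 := mul_le_mul_of_nonneg_left h2 hlam.le
    rcases (norm_nonneg (L (g - p))).eq_or_lt with h0 | h0
    · rw [← h0]
      positivity
    · nlinarith
  have h6 : L (g - f) = L (g - p) - L (f - p) := by rw [← map_sub]; congr 1; abel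
  rw [h6]
  exact (norm_sub_le _ _).trans (by linarith)

end PenalizedProjection

/-! ### Expectations and variances for independent samples. -/

theorem IsSampleOf.integral_comp {Ω : Type*} [MeasurableSpace Ω] {P : Measure Ω} {d M : ℕ}
    {Y : Fin M → Ω → UnitCube d} {f : UnitCube d → ℝ} (hY : IsSampleOf P Y f) (hf : Continuous f)
    {φ : UnitCube d → ℝ} (hφ : Continuous φ) (m : Fin M) :
    ∫ ω, φ (Y m ω) ∂P = ∫ x, f x * φ x := by
  rw [← integral_map (hY.measurable m).aemeasurable hφ.aestronglyMeasurable, hY.law,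
    integral_withDensity_eq_integral_toReal_smul hf.measurable.ennreal_ofReal
      (Filter.Eventually.of_forall fun x => ENNReal.ofReal_lt_top)]
  refine integral_congr_ae (Filter.Eventually.of_forall fun x => ?_)
  simp [ENNReal.toReal_ofReal (hY.nonneg x)]

theorem IsSampleOf.integral_eq_one {Ω : Type*} [MeasurableSpace Ω] {P : Measure Ω}
    [IsProbabilityMeasure P] {d M : ℕ} {Y : Fin M → Ω → UnitCube d} {f : UnitCube d → ℝ}
    (hY : IsSampleOf P Y f) (hf : Continuous f) (hM : 1 ≤ M) : ∫ x, f x = 1 := by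
  have := hY.integral_comp hf (φ := fun _ => 1) continuous_const ⟨0, hM⟩
  simpa using this.symm

theorem integrable_of_continuous_unitCube {d : ℕ} {φ : UnitCube d → ℝ} (hφ : Continuous φ) :
    Integrable φ :=
  hφ.integrable_of_hasCompactSupport (HasCompactSupport.of_compactSpace _)

theorem memLp_comp_of_continuous {Ω : Type*} [MeasurableSpace Ω] (P : Measure Ω)
    [IsFiniteMeasure P] {d : ℕ} {φ : UnitCube d → ℝ} (hφ : Continuous φ) {Y : Ω → UnitCube d}
    (hY : Measurable Y) (p : ℝ≥0∞) : MemLp (fun ω => φ (Y ω)) p P := by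
  obtain ⟨C, hC⟩ := (isCompact_range hφ).isBounded.exists_norm_le
  exact MemLp.of_bound (hφ.measurable.comp hY).aestronglyMeasurable C
    (Filter.Eventually.of_forall fun ω => hC _ ⟨Y ω, rfl⟩)

/-- The variance of an empirical mean. -/
theorem IsSampleOf.integral_sq_mean_sub_le {Ω : Type*} [MeasurableSpace Ω] {P : Measure Ω}
    [IsProbabilityMeasure P] {d M : ℕ} {Y : Fin M → Ω → UnitCube d} {f : UnitCube d → ℝ}
    (hY : IsSampleOf P Y f) (hf : Continuous f) (hM : 1 ≤ M) {φ : UnitCube d → ℝ}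
    (hφ : Continuous φ) :
    Integrable (fun ω => ((M : ℝ)⁻¹ * ∑ m, φ (Y m ω) - ∫ x, f x * φ x) ^ 2) P ∧
    ∫ ω, ((M : ℝ)⁻¹ * ∑ m, φ (Y m ω) - ∫ x, f x * φ x) ^ 2 ∂P ≤
      (M : ℝ)⁻¹ * ∫ x, f x * φ x ^ 2 := by
  have hmem : ∀ m, MemLp (fun ω => φ (Y m ω)) 2 P := fun m =>
    memLp_comp_of_continuous P hφ (hY.measurable m) 2
  have hM0 : (M : ℝ) ≠ 0 := by positivity
  have hsum : MemLp (∑ m, fun ω => φ (Y m ω)) 2 P := memLp_finsetSum' _ fun m _ => hmem m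
  have hmean : ∫ ω, (∑ m, fun ω => φ (Y m ω)) ω ∂P = M * ∫ x, f x * φ x := by
    simp only [Finset.sum_apply]
    rw [integral_finsetSum _ fun m _ => (hmem m).integrable (by norm_num)]
    simp [hY.integral_comp hf hφ]
  have hvar : Var[∑ m, fun ω => φ (Y m ω); P] ≤ M * ∫ x, f x * φ x ^ 2 := by
    rw [IndepFun.variance_sum (fun m _ => hmem m) fun i _ j _ hij =>
      (hY.indep.indepFun hij).comp hφ.measurable hφ.measurable]
    calc ∑ m, Var[fun ω => φ (Y m ω); P] ≤ ∑ _m : Fin M, ∫ x, f x * φ x ^ 2 := by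
          refine Finset.sum_le_sum fun m _ => ?_
          refine (variance_le_expectation_sq (hmem m).1).trans (le_of_eq ?_)
          exact hY.integral_comp hf (hφ.pow 2) m
      _ = _ := by simp
  have e : ∀ ω, ((M : ℝ)⁻¹ * ∑ m, φ (Y m ω) - ∫ x, f x * φ x) ^ 2 =
      ((M : ℝ)⁻¹) ^ 2 * ((∑ m, fun ω => φ (Y m ω)) ω - P[∑ m, fun ω => φ (Y m ω)]) ^ 2 := by
    intro ω
    rw [hmean, ← mul_pow, mul_sub, ← mul_assoc, inv_mul_cancel₀ hM0, one_mul]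
    simp
  constructor
  · simp only [e]
    exact ((hsum.sub (memLp_const _)).integrable_sq).const_mul _
  · simp only [e]
    rw [integral_const_mul, ← variance_eq_integral hsum.1.aemeasurable]
    calc ((M : ℝ)⁻¹) ^ 2 * Var[∑ m, fun ω => φ (Y m ω); P]
        ≤ ((M : ℝ)⁻¹) ^ 2 * (M * ∫ x, f x * φ x ^ 2) :=
          mul_le_mul_of_nonneg_left hvar (by positivity)
      _ = _ := by field_simp

/-! ### Bias–variance decomposition of the mean integrated squared error. -/

section Korobov

open RKHS

variable {α : ℝ} {γ : Finset ℕ → ℝ≥0} {d : ℕ}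

theorem korobovCoeff_neg (h : Fin d → ℤ) : korobovCoeff α γ d (-h) = korobovCoeff α γ d h := by
  simp [korobovCoeff, freqSupport]

theorem continuous_rkhs {ρ : (Fin d → ℤ) → ℝ≥0} (hρ : Summable fun h => (ρ h : ℝ))
    (hev : ∀ h, ρ (-h) = ρ h) (f : OfKernel (fourierKernelMatrix ρ)) : Continuous f := by
  obtain ⟨T, hT, -⟩ := exists_fourierIsometry hρ hev
  exact continuous_of_hasSum_fourierMode (summable_norm_sqrt_mul hρ (T f)) (hT f)

theorem exists_toL2 {ρ : (Fin d → ℤ) → ℝ≥0} (hρ : Summable fun h => (ρ h : ℝ))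
    (hev : ∀ h, ρ (-h) = ρ h) :
    ∃ L : OfKernel (fourierKernelMatrix ρ) →ₗ[ℝ] Lp ℝ 2 (volume : Measure (UnitCube d)),
      ∀ f g, inner ℝ (L f) (L g) = ∫ x, f x * g x := by
  have hmem : ∀ f : OfKernel (fourierKernelMatrix ρ),
      MemLp (fun x => f x) 2 (volume : Measure (UnitCube d)) := fun f =>
    memLp_comp_of_continuous volume (continuous_rkhs hρ hev f) measurable_id 2
  let L : OfKernel (fourierKernelMatrix ρ) →ₗ[ℝ] Lp ℝ 2 (volume : Measure (UnitCube d)) :=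
    { toFun := fun f => (hmem f).toLp
      map_add' := fun f g => by
        rw [← MemLp.toLp_add]
        exact MemLp.toLp_congr _ _ (by simp; rfl)
      map_smul' := fun c f => by
        rw [RingHom.id_apply, ← MemLp.toLp_const_smul]
        exact MemLp.toLp_congr _ _ (by simp; rfl) }
  refine ⟨L, fun f g => ?_⟩
  rw [L2.inner_def]
  refine integral_congr_ae ?_
  filter_upwards [(hmem f).coeFn_toLp, (hmem g).coeFn_toLp] with x h1 h2
  change inner ℝ ((MemLp.toLp (fun x => f x) (hmem f) : Lp ℝ 2 volume) x)
    ((MemLp.toLp (fun x => g x) (hmem g) : Lp ℝ 2 volume) x) = _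
  rw [h1, h2]
  simp [mul_comm]

/-- Insert the noise-free solution `g₀` between estimator and density and use `(a + b)² ≤ 2a² +
2b²`. Here `b` bounds the squared bias, and `Lam` bounds point evaluation in the penalized norm,
which controls the variance. -/
theorem mise_le (hρ : Summable fun h => (korobovCoeff α γ d h : ℝ)) {N M : ℕ} {z : Fin d → ℕ}
    {lam b Lam : ℝ} (hlam : 0 < lam) (hLam0 : 0 ≤ Lam) (hM : 1 ≤ M) {Ω : Type*}
    [MeasurableSpace Ω] {P : Measure Ω} [IsProbabilityMeasure P] {f : UnitCube d → ℝ} {u : KorobovSpace α γ d} (hu : ∀ x, u x = f x)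
    {Y : Fin M → Ω → UnitCube d} (hY : IsSampleOf P Y f)
    (hLam : ∀ (v : KorobovSpace α γ d) y,
      v y ^ 2 ≤ Lam * ((∫ x, v x ^ 2) + lam * ‖v‖ ^ 2))
    (hb : ∀ g ∈ latticeSpan α γ d N z, (∀ v ∈ latticeSpan α γ d N z,
      (∫ x, g x * v x) + lam * inner ℝ g v = ∫ x, u x * v x) → ∫ x, (g x - u x) ^ 2 ≤ b) :
    mise P α γ N z lam Y f ≤ ENNReal.ofReal (2 * b + 2 * ((M : ℝ)⁻¹ * Lam)) := by
  set V := latticeSpan α γ d N z with hV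
  have : FiniteDimensional ℝ V :=
    FiniteDimensional.span_of_finite ℝ ((Set.finite_Icc 1 N).image _)
  have hcont : ∀ v : KorobovSpace α γ d, Continuous v := continuous_rkhs hρ korobovCoeff_neg
  have hfu : f = u := funext fun x => (hu x).symm
  subst hfu
  obtain ⟨L, hL⟩ := exists_toL2 hρ (korobovCoeff_neg (α := α) (γ := γ) (d := d))
  have hLsq : ∀ v : KorobovSpace α γ d, ‖L v‖ ^ 2 = ∫ x, v x ^ 2 := fun v => by
    rw [← real_inner_self_eq_norm_sq, hL]
    simp only [sq]
  obtain ⟨n, φ, hφV, hφ, hrep⟩ := exists_orthonormal_penalizedForm L hlam V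
  have hsymm : ∀ v w, penalizedForm L lam v w = penalizedForm L lam w v := fun v w => by
    rw [penalizedForm_apply, penalizedForm_apply, real_inner_comm, real_inner_comm v w]
  have hnorm : ∀ a : Fin n → ℝ,
      penalizedForm L lam (∑ i, a i • φ i) (∑ i, a i • φ i) = ∑ i, a i ^ 2 := by
    intro a
    simp only [map_sum, map_smul, LinearMap.sum_apply, LinearMap.smul_apply, hφ, smul_eq_mul]
    simp [sq]
  have hpen : ∀ v, ‖L v‖ ^ 2 ≤ penalizedForm L lam v v := fun v => by
    rw [penalizedForm_apply, real_inner_self_eq_norm_sq, real_inner_self_eq_norm_sq]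
    have : 0 ≤ lam * ‖v‖ ^ 2 := by positivity
    linarith
  set g₀ : KorobovSpace α γ d := ∑ i, (∫ x, u x * φ i x) • φ i with hg₀
  have hg₀V : g₀ ∈ V := V.sum_mem fun i _ => V.smul_mem _ (hφV i)
  have hbias : ‖L (g₀ - u)‖ ^ 2 ≤ b := by
    rw [hLsq]
    simp only [coe_sub, Pi.sub_apply]
    refine hb g₀ hg₀V fun v hv => ?_
    rw [← hL, ← penalizedForm_apply, ← hL, hg₀]
    conv_rhs => rw [hrep v hv]
    simp only [map_sum, map_smul, LinearMap.sum_apply, LinearMap.smul_apply, smul_eq_mul,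
      inner_sum, inner_smul_right, hL]
    refine Finset.sum_congr rfl fun i _ => ?_
    rw [hsymm (φ i) v, mul_comm]
  set ξ : Fin n → Ω → ℝ := fun i ω => (M : ℝ)⁻¹ * ∑ m, φ i (Y m ω) - ∫ x, u x * φ i x with hξ
  -- In the orthonormal basis the variational equations decouple: the coordinates of the estimator
  -- are the empirical means of the `φ i`, those of `g₀` their expectations.
  have hest : ∀ ω, kernelEstimator α γ N z lam (fun m => Y m ω) - g₀ = ∑ i, ξ i ω • φ i := by
    intro ω
    obtain ⟨h1, h2⟩ := kernelEstimator_spec α γ N z hlam (fun m => Y m ω)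
    have h3 := hrep _ h1
    have h4 : ∀ i, penalizedForm L lam (kernelEstimator α γ N z lam fun m => Y m ω) (φ i) =
        (M : ℝ)⁻¹ * ∑ m, φ i (Y m ω) := fun i => by
      rw [penalizedForm_apply, hL]
      exact h2 _ (hφV i)
    simp only [h4] at h3
    rw [h3, hg₀, ← Finset.sum_sub_distrib]
    simp only [hξ, sub_smul]
  have hpt : ∀ ω, ∫⁻ x, ENNReal.ofReal
      (|kernelEstimator α γ N z lam (fun m => Y m ω) x - u x| ^ 2) ≤
      ENNReal.ofReal (2 * b + 2 * ∑ i, ξ i ω ^ 2) := by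
    intro ω
    set g := kernelEstimator α γ N z lam (fun m => Y m ω)
    have hint : Integrable fun x => (g x - u x) ^ 2 :=
      integrable_of_continuous_unitCube (((hcont g).sub (hcont u)).pow 2)
    simp only [sq_abs]
    rw [← ofReal_integral_eq_lintegral_ofReal hint
      (Filter.Eventually.of_forall fun x => sq_nonneg _)]
    refine ENNReal.ofReal_le_ofReal ?_
    have h1 : ∫ x, (g x - u x) ^ 2 = ‖L (g - u)‖ ^ 2 := by
      rw [hLsq]
      simp
    have h2 : L (g - u) = L (g - g₀) + L (g₀ - u) := by rw [← map_add]; congr 1; abel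
    have h3 : ‖L (g - g₀)‖ ^ 2 ≤ ∑ i, ξ i ω ^ 2 := by
      rw [hest, ← hnorm fun i => ξ i ω]
      exact hpen _
    rw [h1, h2]
    have h4 := pow_le_pow_left₀ (norm_nonneg _) (norm_add_le (L (g - g₀)) (L (g₀ - u))) 2
    nlinarith [sq_nonneg (‖L (g - g₀)‖ - ‖L (g₀ - u)‖)]
  have hφvar := fun i => hY.integral_sq_mean_sub_le (hcont u) hM (hcont (φ i))
  have hb0 : 0 ≤ b := (sq_nonneg _).trans hbias
  -- For `v = Σ φ_i(y) φ_i` both `v y` and the squared penalized norm equal `S = Σ φ_i(y)²`, so the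
  -- evaluation bound reads `S² ≤ Lam * S`.
  have hsumφ : ∀ y, ∑ i, φ i y ^ 2 ≤ Lam := by
    intro y
    set v : KorobovSpace α γ d := ∑ i, φ i y • φ i with hv
    have h1 : v y = ∑ i, φ i y ^ 2 := by
      have : v y = coeCLM ℝ v y := rfl
      rw [this, hv, map_sum]
      simp [sq]
    have h2 := hLam v y
    have h3 : (∫ x, v x ^ 2) + lam * ‖v‖ ^ 2 = ∑ i, φ i y ^ 2 := by
      rw [← hnorm, penalizedForm_apply, real_inner_self_eq_norm_sq, real_inner_self_eq_norm_sq,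
        hLsq]
    rw [h1, h3] at h2
    have h5 : 0 ≤ ∑ i, φ i y ^ 2 := Finset.sum_nonneg fun i _ => sq_nonneg _
    rcases h5.eq_or_lt with h6 | h6
    · rw [← h6]
      exact hLam0
    · nlinarith
  have hone := hY.integral_eq_one (hcont u) hM
  have hvar : ∑ i, ∫ ω, ξ i ω ^ 2 ∂P ≤ (M : ℝ)⁻¹ * Lam := by
    calc ∑ i, ∫ ω, ξ i ω ^ 2 ∂P ≤ ∑ i, (M : ℝ)⁻¹ * ∫ x, u x * φ i x ^ 2 :=
          Finset.sum_le_sum fun i _ => (hφvar i).2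
      _ = (M : ℝ)⁻¹ * ∫ x, u x * ∑ i, φ i x ^ 2 := by
          rw [← Finset.mul_sum, ← integral_finsetSum (f := fun i x => u x * φ i x ^ 2) _ fun i _ =>
            integrable_of_continuous_unitCube ((hcont u).mul ((hcont (φ i)).pow 2))]
          simp only [Finset.mul_sum]
      _ ≤ (M : ℝ)⁻¹ * ∫ x, u x * Lam := by
          refine mul_le_mul_of_nonneg_left ?_ (by positivity)
          refine integral_mono (integrable_of_continuous_unitCube ((hcont u).mul
            (continuous_finsetSum _ fun i _ => (hcont (φ i)).pow 2)))
            (integrable_of_continuous_unitCube ((hcont u).mul continuous_const)) fun x => ?_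
          exact mul_le_mul_of_nonneg_left (hsumφ x) (hY.nonneg x)
      _ = (M : ℝ)⁻¹ * Lam := by rw [integral_mul_const, hone, one_mul]
  calc mise P α γ N z lam Y u ≤ ∫⁻ ω, ENNReal.ofReal (2 * b + 2 * ∑ i, ξ i ω ^ 2) ∂P :=
        lintegral_mono hpt
    _ = ENNReal.ofReal (∫ ω, (2 * b + 2 * ∑ i, ξ i ω ^ 2) ∂P) := by
        rw [ofReal_integral_eq_lintegral_ofReal]
        · exact (integrable_const _).add
            ((integrable_finsetSum _ fun i _ => (hφvar i).1).const_mul 2)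
        · exact Filter.Eventually.of_forall fun ω => by positivity
    _ ≤ _ := by
        refine ENNReal.ofReal_le_ofReal ?_
        rw [integral_add (integrable_const _)
            ((integrable_finsetSum _ fun i _ => (hφvar i).1).const_mul 2), integral_const,
          probReal_univ, one_smul, integral_const_mul (2 : ℝ),
          integral_finsetSum (f := fun i ω => ξ i ω ^ 2) _ fun i _ => (hφvar i).1]
        linarith

end Korobov

/-! ### Bias in the Korobov space and in the smaller space. -/

section Bias

open RKHS

variable {d : ℕ}

/-- The frequency `0` has weight `1` and coefficient `∫ f = 1`. This lets the variance term, which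
carries no norm of `f`, be absorbed into a multiple of `‖f‖²`. -/
theorem one_le_norm_of_integral_eq_one {ρ : (Fin d → ℤ) → ℝ≥0}
    (hρ : Summable fun h => (ρ h : ℝ)) (hev : ∀ h, ρ (-h) = ρ h) (h0 : ρ 0 = 1)
    {f : OfKernel (fourierKernelMatrix ρ)} (hf : ∫ x, f x = 1) : 1 ≤ ‖f‖ := by
  obtain ⟨T, hT, -⟩ := exists_fourierIsometry hρ hev
  have h1 := integral_mul_fourierMode_neg (summable_norm_sqrt_mul hρ (T f)) (hT f) 0
  have h2 : ∀ x : UnitCube d, fourierMode (-0 : Fin d → ℤ) x = 1 := fun x => by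
    simp [fourierMode, fourierPhase]
  simp only [h2, mul_one, h0] at h1
  rw [integral_complex_ofReal, hf] at h1
  have h3 := lp.norm_apply_le_norm (p := 2) (by norm_num) (T f) 0
  rw [T.norm_map] at h3
  have h4 : T f 0 = 1 := by simpa using h1.symm
  rw [h4] at h3
  simpa using h3

/-- The functions of the smaller space, seen in the larger space. -/
theorem exists_eq_of_sq_kernel {ρ : (Fin d → ℤ) → ℝ≥0} (hρ : Summable fun h => (ρ h : ℝ))
    (hev : ∀ h, ρ (-h) = ρ h) {R : ℝ} (hR : ∀ h, (ρ h : ℝ) ≤ R)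
    (f : OfKernel (fourierKernelMatrix fun h => ρ h ^ 2)) :
    ∃ u : OfKernel (fourierKernelMatrix ρ), (∀ x, u x = f x) ∧ ‖u‖ ^ 2 ≤ R * ‖f‖ ^ 2 ∧
      ∀ v : OfKernel (fourierKernelMatrix ρ), |inner ℝ u v| ≤ ‖f‖ * √(∫ x, v x ^ 2) := by
  have hρ2 : Summable fun h => ((ρ h ^ 2 : ℝ≥0) : ℝ) := by
    refine Summable.of_nonneg_of_le (fun h => (ρ h ^ 2).coe_nonneg) (fun h => ?_) (hρ.mul_left R)
    push_cast
    rw [sq]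
    exact mul_le_mul_of_nonneg_right (hR h) (ρ h).coe_nonneg
  obtain ⟨T, hT, hT'⟩ := exists_fourierIsometry hρ hev
  obtain ⟨S, hS, -⟩ := exists_fourierIsometry hρ2 fun h => by rw [hev]
  have hmul : ∀ w : FourierSeq d, Memℓp (fun h => ((√(ρ h : ℝ) : ℝ) : ℂ) * w h) 2 := by
    intro w
    refine memℓp_gen ?_
    refine Summable.of_nonneg_of_le (fun h => by positivity) (fun h => ?_)
      ((FourierSeq.hasSum_norm_sq w).summable.mul_left R)
    have : ‖((√(ρ h : ℝ) : ℝ) : ℂ) * w h‖ ^ 2 = ρ h * ‖w h‖ ^ 2 := by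
      rw [norm_mul, Complex.norm_real, Real.norm_of_nonneg (Real.sqrt_nonneg _), mul_pow,
        Real.sq_sqrt (ρ h).coe_nonneg]
    rw [ENNReal.toReal_ofNat, Real.rpow_ofNat, this]
    exact mul_le_mul_of_nonneg_right (hR h) (sq_nonneg ‖w h‖)
  have hnorm : ∀ w : FourierSeq d, HasSum (fun h => (ρ h : ℝ) * ‖w h‖ ^ 2)
      (‖(⟨_, hmul w⟩ : FourierSeq d)‖ ^ 2) := by
    intro w
    refine (FourierSeq.hasSum_norm_sq (⟨_, hmul w⟩ : FourierSeq d)).of_eq fun h => ?_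
    rw [norm_mul, Complex.norm_real, Real.norm_of_nonneg (Real.sqrt_nonneg _), mul_pow,
      Real.sq_sqrt (ρ h).coe_nonneg]
  obtain ⟨u, hu, hun, hui⟩ := hT' ⟨_, hmul (S f)⟩ f fun x => by
    refine (hS f x).of_eq fun h => ?_
    push_cast
    rw [Real.sqrt_sq (ρ h).coe_nonneg, ← mul_assoc, ← Complex.ofReal_mul,
      Real.mul_self_sqrt (ρ h).coe_nonneg]
  refine ⟨u, hu, ?_, fun v => ?_⟩
  · refine (pow_le_pow_left₀ (norm_nonneg _) hun 2).trans ?_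
    have h1 := (FourierSeq.hasSum_norm_sq (S f)).mul_left R
    rw [S.norm_map] at h1
    exact hasSum_le (fun h => mul_le_mul_of_nonneg_right (hR h) (sq_nonneg _)) (hnorm (S f)) h1
  -- A factor `√ρ` moves from one argument to the other. Then `√ρ · T v` is the sequence of Fourier
  -- coefficients of `v`, whose norm is the `L²` norm.
  · have h1 : inner ℝ (⟨_, hmul (S f)⟩ : FourierSeq d) (T v) =
        inner ℝ (S f) (⟨_, hmul (T v)⟩ : FourierSeq d) := by
      rw [lp.inner_eq_tsum, lp.inner_eq_tsum]
      refine tsum_congr fun h => ?_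
      simp only [Complex.inner, map_mul, Complex.conj_ofReal]
      congr 1
      ring
    have h2 : ‖(⟨_, hmul (T v)⟩ : FourierSeq d)‖ = √(∫ x, v x ^ 2) := by
      rw [← Real.sqrt_sq (norm_nonneg (⟨_, hmul (T v)⟩ : FourierSeq d)),
        (hnorm (T v)).unique (hasSum_integral_sq_of_isometry hρ (hT v))]
    rw [hui, h1, ← h2, ← S.norm_map]
    exact abs_real_inner_le_norm _ _

variable {α : ℝ} {γ : Finset ℕ → ℝ≥0}

/-- The witness is the orthogonal projection onto `V_N`. By the reproducing property, orthogonality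
to the kernel sections at the lattice points says that `u - p` vanishes on the lattice. -/
theorem exists_lattice_projection (hρ : Summable fun h => (korobovCoeff α γ d h : ℝ)) {N : ℕ}
    (hN : N ≠ 0) {z : Fin d → ℕ} {s : ℝ} (hs : 0 < s)
    (hS : aliasingSum (fun h => (korobovCoeff α γ d h : ℝ≥0∞)) N z ≤ ENNReal.ofReal s)
    (u : KorobovSpace α γ d) :
    ∃ p ∈ latticeSpan α γ d N z, (∀ v ∈ latticeSpan α γ d N z, inner ℝ (u - p) v = 0) ∧
      ‖p‖ ≤ ‖u‖ ∧ ∫ x, (u x - p x) ^ 2 ≤ 2 * √s * ‖u‖ ^ 2 := by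
  set V := latticeSpan α γ d N z with hV
  have : FiniteDimensional ℝ V :=
    FiniteDimensional.span_of_finite ℝ ((Set.finite_Icc 1 N).image _)
  obtain ⟨p, hp, hup⟩ := V.exists_norm_eq_iInf_of_complete_subspace
    (Submodule.complete_of_finiteDimensional V) u
  have horth := (V.norm_eq_iInf_iff_real_inner_eq_zero hp).1 hup
  have hpyth : ‖u‖ ^ 2 = ‖u - p‖ ^ 2 + ‖p‖ ^ 2 := by
    have := norm_add_sq_real (u - p) p
    rw [horth p hp, sub_add_cancel] at this
    linarith
  refine ⟨p, hp, horth, ?_, ?_⟩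
  · nlinarith [norm_nonneg u, norm_nonneg p, sq_nonneg ‖u - p‖]
  · obtain ⟨T, hT, -⟩ := exists_fourierIsometry hρ korobovCoeff_neg
    have h1 := integral_sq_le_of_vanish_lattice hρ hN hs hS (hT (u - p)) fun k hk => by
      have h2 := horth _ (Submodule.subset_span ⟨k, Finset.mem_Icc.1 hk, rfl⟩)
      rw [inner_kerFun] at h2
      simpa using h2
    simp only [coe_sub, Pi.sub_apply, T.norm_map] at h1
    refine h1.trans (mul_le_mul_of_nonneg_left ?_ (by positivity))
    nlinarith [sq_nonneg ‖p‖]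

theorem integral_sq_bias_le (hρ : Summable fun h => (korobovCoeff α γ d h : ℝ)) {N : ℕ}
    (hN : N ≠ 0) {z : Fin d → ℕ} {s lam : ℝ} (hs : 0 < s) (hlam : 0 < lam)
    (hS : aliasingSum (fun h => (korobovCoeff α γ d h : ℝ≥0∞)) N z ≤ ENNReal.ofReal s)
    {u g : KorobovSpace α γ d} (hg : g ∈ latticeSpan α γ d N z)
    (hgu : ∀ v ∈ latticeSpan α γ d N z,
      (∫ x, g x * v x) + lam * inner ℝ g v = ∫ x, u x * v x) :
    ∫ x, (g x - u x) ^ 2 ≤ 2 * √s * ‖u‖ ^ 2 + lam * ‖u‖ ^ 2 := by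
  obtain ⟨p, hp, -, hpn, hpu⟩ := exists_lattice_projection hρ hN hs hS u
  obtain ⟨L, hL⟩ := exists_toL2 hρ (korobovCoeff_neg (α := α) (γ := γ) (d := d))
  have hLsq : ∀ v w : KorobovSpace α γ d, ‖L (v - w)‖ ^ 2 = ∫ x, (v x - w x) ^ 2 := fun v w => by
    rw [← real_inner_self_eq_norm_sq, hL]
    simp [sq]
  have h1 := norm_sq_penalized_le (L := L) hlam hg hp (f := u) fun v hv => by
    rw [penalizedForm_apply, hL, hL]
    exact hgu v hv
  rw [hLsq, hLsq] at h1
  have h2 : ‖p‖ ^ 2 ≤ ‖u‖ ^ 2 := pow_le_pow_left₀ (norm_nonneg _) hpn 2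
  nlinarith

theorem integral_sq_bias_le_of_smooth (hρ : Summable fun h => (korobovCoeff α γ d h : ℝ)) {N : ℕ}
    (hN : N ≠ 0) {z : Fin d → ℕ} {s lam A : ℝ} (hs : 0 < s) (hlam : 0 < lam) (hA0 : 0 ≤ A)
    (hS : aliasingSum (fun h => (korobovCoeff α γ d h : ℝ≥0∞)) N z ≤ ENNReal.ofReal s)
    {u g : KorobovSpace α γ d} (hA : ∀ v : KorobovSpace α γ d,
      |inner ℝ u v| ≤ A * √(∫ x, v x ^ 2)) (hg : g ∈ latticeSpan α γ d N z)
    (hgu : ∀ v ∈ latticeSpan α γ d N z,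
      (∫ x, g x * v x) + lam * inner ℝ g v = ∫ x, u x * v x) :
    ∫ x, (g x - u x) ^ 2 ≤ 16 * √s * ‖u‖ ^ 2 + 2 * lam ^ 2 * A ^ 2 := by
  obtain ⟨p, hp, horth, -, hpu⟩ := exists_lattice_projection hρ hN hs hS u
  obtain ⟨L, hL⟩ := exists_toL2 hρ (korobovCoeff_neg (α := α) (γ := γ) (d := d))
  have hLsq : ∀ v w : KorobovSpace α γ d, ‖L (v - w)‖ ^ 2 = ∫ x, (v x - w x) ^ 2 := fun v w => by
    rw [← real_inner_self_eq_norm_sq, hL]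
    simp [sq]
  have h1 := norm_penalized_le (L := L) hlam hA0 hg hp (f := u)
    (fun v hv => by
      rw [penalizedForm_apply, hL, hL]
      exact hgu v hv) horth fun v _ => by
    have h2 : ‖L v‖ = √(∫ x, v x ^ 2) := by
      rw [← Real.sqrt_sq (norm_nonneg (L v)), ← real_inner_self_eq_norm_sq, hL]
      simp only [sq]
    rw [h2]
    exact hA v
  rw [← hLsq] at hpu ⊢
  have h2 := pow_le_pow_left₀ (norm_nonneg _) h1 2
  -- With `a = ‖L (u - p)‖`, `(2a + lam A)² ≤ 8a² + 2 lam² A²`, and `a² ≤ 2√s ‖u‖²` yields the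
  -- constant `16`.
  nlinarith [sq_nonneg (2 * ‖L (u - p)‖ - lam * A)]

end Bias

/-! ### Product sums and subadditivity of powers. -/

theorem ENNReal.tsum_pi_prod {ι : Type*} :
    ∀ {d : ℕ} (f : Fin d → ι → ℝ≥0∞), ∑' h : Fin d → ι, ∏ i, f i (h i) = ∏ i, ∑' k, f i k
  | 0, f => by simp
  | d + 1, f => by
    rw [← (Fin.consEquiv fun _ => ι).tsum_eq, ENNReal.tsum_prod', Fin.prod_univ_succ,
      ← ENNReal.tsum_mul_right]
    refine tsum_congr fun k => ?_
    rw [← ENNReal.tsum_pi_prod, ← ENNReal.tsum_mul_left]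
    refine tsum_congr fun h => ?_
    simp [Fin.prod_univ_succ, Fin.consEquiv]

theorem ENNReal.rpow_tsum_le_tsum_rpow {ι : Type*} (f : ι → ℝ≥0∞) {q : ℝ} (hq0 : 0 < q)
    (hq1 : q ≤ 1) : (∑' i, f i) ^ q ≤ ∑' i, f i ^ q := by
  have h1 : ∀ s : Finset ι, (∑ i ∈ s, f i) ^ q ≤ ∑' i, f i ^ q := fun s =>
    (Finset.le_sum_of_subadditive (fun x : ℝ≥0∞ => x ^ q) (ENNReal.zero_rpow_of_pos hq0).le
      (fun x y => ENNReal.rpow_add_le_add_rpow x y hq0.le hq1) s f).trans (ENNReal.sum_le_tsum s)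
  have h2 : Filter.Tendsto (fun s : Finset ι => (∑ i ∈ s, f i) ^ q) Filter.atTop
      (nhds ((∑' i, f i) ^ q)) :=
    (ENNReal.continuous_rpow_const.tendsto _).comp ENNReal.summable.hasSum
  exact le_of_tendsto' h2 h1

/-! ### Sums of powers of the Korobov weights. -/

section Weights

variable {α : ℝ} {γ : Finset ℕ → ℝ≥0} {d : ℕ}

/-- The summand of `2 ζ(a) = ∑_{k ≠ 0} |k|^{-a}`. -/
noncomputable def zetaTerm (a : ℝ) (k : ℤ) : ℝ≥0∞ :=
  if k = 0 then 0 else (k.natAbs : ℝ≥0∞) ^ (-a)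

/-- The factor of the coordinate `i` in the part of the kernel with support `s`. -/
noncomputable def supportFactor (a : ℝ) (s : Finset (Fin d)) (i : Fin d) (k : ℤ) : ℝ≥0∞ :=
  if i ∈ s then zetaTerm a k else if k = 0 then 1 else 0

/-- The sum `∑_{s ⊆ [d]} max(|s|,1) γ_s^q [2 ζ(α q)]^{|s|}`. -/
noncomputable def weightSum (α : ℝ) (γ : Finset ℕ → ℝ≥0) (d : ℕ) (q : ℝ) : ℝ≥0∞ :=
  ∑ s : Finset (Fin d), (max s.card 1 : ℕ) * (γ (s.map Fin.valEmbedding) : ℝ≥0∞) ^ q *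
    (∑' k, zetaTerm (α * q) k) ^ s.card

/-- Only the term with `s = supp h` survives. Each summand is a product over coordinates, so sums
over frequencies factor into one-dimensional ones. -/
theorem korobovCoeff_rpow_eq_sum {q : ℝ} (hq : 0 < q) (h : Fin d → ℤ) :
    (korobovCoeff α γ d h : ℝ≥0∞) ^ q = ∑ s : Finset (Fin d),
      (γ (s.map Fin.valEmbedding) : ℝ≥0∞) ^ q * ∏ i, supportFactor (α * q) s i (h i) := by
  rw [Finset.sum_eq_single (Finset.univ.filter fun j => h j ≠ 0)]
  · rw [korobovCoeff, ENNReal.coe_mul, ENNReal.mul_rpow_of_nonneg _ _ hq.le, freqSupport]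
    congr 1
    rw [ENNReal.ofNNReal_finsetProd, ← ENNReal.prod_rpow_of_nonneg hq.le, Finset.prod_filter]
    refine Finset.prod_congr rfl fun j _ => ?_
    by_cases hj : h j = 0
    · simp [supportFactor, hj]
    · have h0 : ((h j).natAbs : ℝ≥0) ≠ 0 := by simpa using hj
      simp only [supportFactor, Finset.mem_filter, Finset.mem_univ, true_and, hj, ne_eq,
        not_false_eq_true, if_true, zetaTerm, if_false]
      rw [ENNReal.coe_rpow_of_ne_zero h0, ← ENNReal.rpow_mul]
      simp
  · intro s _ hs
    obtain ⟨i, hi⟩ : ∃ i, ¬ (i ∈ s ↔ h i ≠ 0) := by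
      by_contra! hcon
      exact hs (by ext i; simp [hcon i])
    refine mul_eq_zero_of_right _ (Finset.prod_eq_zero (Finset.mem_univ i) ?_)
    unfold supportFactor zetaTerm
    by_cases his : i ∈ s <;> by_cases hi0 : h i = 0 <;> simp_all
  · simp

theorem tsum_supportFactor (a : ℝ) (s : Finset (Fin d)) (i : Fin d) :
    ∑' k, supportFactor a s i k = if i ∈ s then ∑' k, zetaTerm a k else 1 := by
  unfold supportFactor
  split_ifs
  · rfl
  · exact tsum_ite_eq 0 _

theorem tsum_korobovCoeff_rpow_le {q : ℝ} (hq : 0 < q) :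
    ∑' h, (korobovCoeff α γ d h : ℝ≥0∞) ^ q ≤ weightSum α γ d q := by
  simp only [korobovCoeff_rpow_eq_sum hq]
  rw [Summable.tsum_finsetSum fun _ _ => ENNReal.summable]
  refine Finset.sum_le_sum fun s _ => ?_
  rw [ENNReal.tsum_mul_left, ENNReal.tsum_pi_prod]
  simp only [tsum_supportFactor, Finset.prod_ite_mem, Finset.univ_inter, Finset.prod_const]
  rw [mul_assoc]
  refine le_mul_of_one_le_left zero_le ?_
  exact_mod_cast le_max_right _ _

/-- The entry `k'` differs from `k` by a multiple of `N` and is the larger one. -/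
def DominatedBy (N : ℕ) (k k' : ℤ) : Prop :=
  k ≠ k' ∧ (N : ℤ) ∣ k' - k ∧ |k| ≤ |k'|

-- Writing `k' = k + N m`, domination gives `N|m| ≤ |k| + |k'| ≤ 2|k'|`, and `k'` is nonzero because
-- `|k| ≤ |k'|` and `k ≠ k'`.
open Classical in
theorem tsum_zetaTerm_dominated_le {a : ℝ} (ha : 0 ≤ a) {N : ℕ} (hN : N ≠ 0) (k : ℤ) :
    ∑' k', (if DominatedBy N k k' then zetaTerm a k' else 0) ≤
      (2 / N : ℝ≥0∞) ^ a * ∑' m, zetaTerm a m := by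
  have hinj : Function.Injective fun m : ℤ => k + N * m := by
    intro m m' h
    have hN' : (N : ℤ) ≠ 0 := by exact_mod_cast hN
    exact mul_left_cancel₀ hN' (add_left_cancel h)
  rw [← hinj.tsum_eq, ← ENNReal.tsum_mul_left]
  · refine ENNReal.tsum_le_tsum fun m => ?_
    split_ifs with hm
    · obtain ⟨h1, -, h3⟩ := hm
      have hm0 : m ≠ 0 := by
        rintro rfl
        simp at h1
      have hk0 : k + N * m ≠ 0 := by
        intro h
        rw [h, abs_zero] at h3
        have : k = 0 := abs_nonpos_iff.1 h3
        exact h1 (this.trans h.symm)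
      simp only [zetaTerm, hm0, hk0, if_false]
      have h4 : N * m.natAbs ≤ 2 * (k + N * m).natAbs := by
        have : (N : ℤ) * |m| ≤ 2 * |k + N * m| := by
          have e : (N : ℤ) * |m| = |N * m| := by rw [abs_mul, Nat.abs_cast]
          have := abs_sub (k + N * m) k
          rw [e]
          rw [add_sub_cancel_left] at this
          linarith
        zify
        exact this
      rw [ENNReal.rpow_neg, ENNReal.rpow_neg, ← ENNReal.inv_rpow, ← ENNReal.inv_rpow,
        ← ENNReal.mul_rpow_of_nonneg _ _ ha]
      refine ENNReal.rpow_le_rpow ?_ ha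
      have h5 : ((N : ℝ≥0∞) * m.natAbs) ≤ 2 * (k + N * m).natAbs := by exact_mod_cast h4
      have h6 := ENNReal.inv_le_inv.2 h5
      rw [ENNReal.mul_inv (by simp) (by simp), ENNReal.mul_inv (by simp) (by simp)] at h6
      calc (((k + N * m).natAbs : ℝ≥0∞))⁻¹ = 2 * (2⁻¹ * ((k + N * m).natAbs : ℝ≥0∞)⁻¹) := by
            rw [← mul_assoc, ENNReal.mul_inv_cancel (by simp) (by simp), one_mul]
        _ ≤ 2 * ((N : ℝ≥0∞)⁻¹ * (m.natAbs : ℝ≥0∞)⁻¹) := mul_le_mul_right h6 _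
        _ = 2 / N * (m.natAbs : ℝ≥0∞)⁻¹ := by rw [div_eq_mul_inv, mul_assoc]
    · exact zero_le
  · intro k' hk'
    have hd : DominatedBy N k k' := by
      by_contra h
      simp [h] at hk'
    obtain ⟨m, hm⟩ := hd.2.1
    exact ⟨m, by simp [← hm]⟩

-- If `j ∈ s`, the `j`-th factor of the product gains `(2/N)^{αq}`; if `j ∉ s`, then `h' j = 0`,
-- which dominates nothing. Summing over `j` produces the factor `|s|`, the reason for `max(|s|, 1)`
-- in the weight sum.
open Classical in
theorem sum_tsum_dominated_le {q : ℝ} (hq : 0 < q) (hα : 0 ≤ α * q) {N : ℕ} (hN : N ≠ 0)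
    (h : Fin d → ℤ) :
    ∑ j, ∑' h', (if DominatedBy N (h j) (h' j) then (korobovCoeff α γ d h' : ℝ≥0∞) ^ q else 0) ≤
      (2 / N : ℝ≥0∞) ^ (α * q) * weightSum α γ d q := by
  set r : ℝ≥0∞ := (2 / N : ℝ≥0∞) ^ (α * q) with hr
  set Z : ℝ≥0∞ := ∑' k, zetaTerm (α * q) k with hZ
  have hj : ∀ j, ∑' h', (if DominatedBy N (h j) (h' j) then
      (korobovCoeff α γ d h' : ℝ≥0∞) ^ q else 0) ≤ ∑ s : Finset (Fin d),
      (γ (s.map Fin.valEmbedding) : ℝ≥0∞) ^ q * (if j ∈ s then r * Z ^ s.card else 0) := by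
    intro j
    have e : ∀ h' : Fin d → ℤ, (if DominatedBy N (h j) (h' j) then
        (korobovCoeff α γ d h' : ℝ≥0∞) ^ q else 0) = ∑ s : Finset (Fin d),
        (γ (s.map Fin.valEmbedding) : ℝ≥0∞) ^ q * ∏ i, (if i = j then
          (if DominatedBy N (h j) (h' i) then supportFactor (α * q) s i (h' i) else 0)
          else supportFactor (α * q) s i (h' i)) := by
      intro h'
      split_ifs with hD
      · rw [korobovCoeff_rpow_eq_sum hq]
        refine Finset.sum_congr rfl fun s _ => ?_
        congr 1
        refine Finset.prod_congr rfl fun i _ => ?_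
        by_cases hij : i = j
        · subst hij
          simp [hD]
        · simp [hij]
      · symm
        refine Finset.sum_eq_zero fun s _ => mul_eq_zero_of_right _ ?_
        exact Finset.prod_eq_zero (Finset.mem_univ j) (by simp [hD])
    simp only [e]
    rw [Summable.tsum_finsetSum fun _ _ => ENNReal.summable]
    refine Finset.sum_le_sum fun s _ => ?_
    rw [ENNReal.tsum_mul_left, ENNReal.tsum_pi_prod (fun i k => if i = j then
          (if DominatedBy N (h j) k then supportFactor (α * q) s i k else 0)
          else supportFactor (α * q) s i k)]
    refine mul_le_mul_right ?_ _
    rw [← Finset.mul_prod_erase _ _ (Finset.mem_univ j)]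
    have hrest : ∏ i ∈ Finset.univ.erase j, ∑' k, (if i = j then
        (if DominatedBy N (h j) k then supportFactor (α * q) s i k else 0)
        else supportFactor (α * q) s i k) = Z ^ (s.erase j).card := by
      have : ∀ i ∈ Finset.univ.erase j, ∑' k, (if i = j then
        (if DominatedBy N (h j) k then supportFactor (α * q) s i k else 0)
        else supportFactor (α * q) s i k) = if i ∈ s then Z else 1 := by
        intro i hi
        simp only [Finset.ne_of_mem_erase hi, if_false]
        exact tsum_supportFactor _ _ _
      rw [Finset.prod_congr rfl this, Finset.prod_ite_mem, Finset.prod_const]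
      congr 2
      ext i
      simp
    rw [hrest]
    simp only [if_true]
    split_ifs with hjs
    · have h1 : ∑' k, (if DominatedBy N (h j) k then supportFactor (α * q) s j k else 0) ≤
          r * Z := by
        simp only [supportFactor, hjs, if_true]
        exact tsum_zetaTerm_dominated_le hα hN (h j)
      refine (mul_le_mul_left h1 _).trans (le_of_eq ?_)
      rw [mul_assoc, ← pow_succ', Finset.card_erase_add_one hjs]
    · rw [ENNReal.tsum_eq_zero.2, zero_mul]
      intro k
      by_cases hD : DominatedBy N (h j) k
      · have hk : k ≠ 0 := by
          rintro rfl
          have h3 := hD.2.2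
          rw [abs_zero] at h3
          exact hD.1 (abs_nonpos_iff.1 h3)
        simp [supportFactor, hjs, hk]
      · simp [hD]
  refine (Finset.sum_le_sum fun j _ => hj j).trans ?_
  rw [Finset.sum_comm, weightSum, Finset.mul_sum]
  refine Finset.sum_le_sum fun s _ => ?_
  rw [← Finset.mul_sum, Finset.sum_ite_mem, Finset.univ_inter, Finset.sum_const, nsmul_eq_mul]
  have h1 : (s.card : ℝ≥0∞) ≤ (max s.card 1 : ℕ) := by exact_mod_cast le_max_left _ _
  calc (γ (s.map Fin.valEmbedding) : ℝ≥0∞) ^ q * (s.card * (r * Z ^ s.card))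
      ≤ (γ (s.map Fin.valEmbedding) : ℝ≥0∞) ^ q * ((max s.card 1 : ℕ) * (r * Z ^ s.card)) := by
        gcongr
    _ = _ := by ring

end Weights

/-! ### Existence of a good generating vector by averaging. -/

section Averaging

variable {α : ℝ} {γ : Finset ℕ → ℝ≥0} {d : ℕ}

open Classical in
/-- The part of the aliasing sum that does not depend on the generating vector. -/
theorem tsum_congruent_le {q : ℝ} (hq : 0 < q) (hα : 0 ≤ α * q) {N : ℕ} (hN : N ≠ 0) :
    ∑' h : Fin d → ℤ, ∑' h', (if h ≠ h' ∧ ∀ j, (N : ℤ) ∣ h' j - h j then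
      (korobovCoeff α γ d h : ℝ≥0∞) ^ q * (korobovCoeff α γ d h' : ℝ≥0∞) ^ q else 0) ≤
      2 * ((2 / N : ℝ≥0∞) ^ (α * q) * weightSum α γ d q ^ 2) := by
  set b : (Fin d → ℤ) → ℝ≥0∞ := fun h => (korobovCoeff α γ d h : ℝ≥0∞) ^ q with hb
  set D : (Fin d → ℤ) → (Fin d → ℤ) → ℝ≥0∞ := fun h h' =>
    ∑ j, (if DominatedBy N (h j) (h' j) then b h' else 0) with hD
  -- In a coordinate where the two frequencies differ, one entry dominates the other. Charging the
  -- pair to that order gives two symmetric terms, hence the factor `2`.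
  have hpt : ∀ h h' : Fin d → ℤ, (if h ≠ h' ∧ ∀ j, (N : ℤ) ∣ h' j - h j then b h * b h' else 0) ≤
      b h * D h h' + b h' * D h' h := by
    intro h h'
    split_ifs with hh
    · obtain ⟨j, hj⟩ := Function.ne_iff.1 hh.1
      rcases le_total |h j| |h' j| with hle | hle
      · have hd : DominatedBy N (h j) (h' j) := ⟨hj, hh.2 j, hle⟩
        refine le_add_right (mul_le_mul_right ?_ _)
        refine le_trans ?_ (Finset.single_le_sum (f := fun j =>
          if DominatedBy N (h j) (h' j) then b h' else 0) (fun _ _ => zero_le) (Finset.mem_univ j))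
        simp [hd]
      · have hd : DominatedBy N (h' j) (h j) :=
          ⟨hj.symm, by rw [← neg_sub]; exact (hh.2 j).neg_right, hle⟩
        rw [mul_comm]
        refine le_add_left (mul_le_mul_right ?_ _)
        refine le_trans ?_ (Finset.single_le_sum (f := fun j =>
          if DominatedBy N (h' j) (h j) then b h else 0) (fun _ _ => zero_le) (Finset.mem_univ j))
        simp [hd]
    · exact zero_le
  have hhalf : ∑' h, ∑' h', b h * D h h' ≤
      (2 / N : ℝ≥0∞) ^ (α * q) * weightSum α γ d q ^ 2 := by
    calc ∑' h, ∑' h', b h * D h h'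
        ≤ ∑' h, b h * ((2 / N : ℝ≥0∞) ^ (α * q) * weightSum α γ d q) := by
          refine ENNReal.tsum_le_tsum fun h => ?_
          rw [ENNReal.tsum_mul_left]
          refine mul_le_mul_right ?_ _
          simp only [hD]
          rw [Summable.tsum_finsetSum fun _ _ => ENNReal.summable]
          exact sum_tsum_dominated_le hq hα hN h
      _ ≤ weightSum α γ d q * ((2 / N : ℝ≥0∞) ^ (α * q) * weightSum α γ d q) := by
          rw [ENNReal.tsum_mul_right]
          exact mul_le_mul_left (tsum_korobovCoeff_rpow_le hq) _
      _ = _ := by ring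
  calc ∑' h : Fin d → ℤ, ∑' h', (if h ≠ h' ∧ ∀ j, (N : ℤ) ∣ h' j - h j then b h * b h' else 0)
      ≤ ∑' h, ∑' h', (b h * D h h' + b h' * D h' h) :=
        ENNReal.tsum_le_tsum fun h => ENNReal.tsum_le_tsum fun h' => hpt h h'
    _ = ∑' h, ∑' h', b h * D h h' + ∑' h, ∑' h', b h' * D h' h := by
        simp only [ENNReal.tsum_add]
    _ = 2 * ∑' h, ∑' h', b h * D h h' := by
        rw [ENNReal.tsum_comm (f := fun h h' => b h' * D h' h), two_mul]
    _ ≤ _ := mul_le_mul_right hhalf _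

/-- A nonzero linear form over `ZMod N` vanishes on at most the fraction `1 / N` of the vectors. -/
theorem card_linear_zero_mul_le {N : ℕ} [Fact N.Prime] {ℓ : Fin d → ZMod N} (hℓ : ℓ ≠ 0) :
    (Finset.univ.filter fun ζ : Fin d → ZMod N => ∑ j, ℓ j * ζ j = 0).card * N ≤ N ^ d := by
  obtain ⟨j, hj⟩ := Function.ne_iff.1 hℓ
  have hj' : ℓ j ≠ 0 := hj
  have hval : ∀ (ζ : Fin d → ZMod N) (t : ZMod N), ∑ i, ℓ i * ζ i = 0 →
      ∑ i, ℓ i * (ζ + Pi.single j t : Fin d → ZMod N) i = ℓ j * t := by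
    intro ζ t h
    simp only [Pi.add_apply, mul_add, Finset.sum_add_distrib, h, zero_add]
    rw [Finset.sum_eq_single j] <;> simp +contextual
  -- Translating the kernel along a coordinate `j` with `ℓ j ≠ 0` gives `N` disjoint copies of it:
  -- the value `ℓ j * t` of the form recovers the shift `t`.
  have := Finset.card_le_card_of_injOn (s := (Finset.univ.filter fun ζ : Fin d → ZMod N =>
    ∑ j, ℓ j * ζ j = 0) ×ˢ (Finset.univ : Finset (ZMod N))) (t := Finset.univ)
    (fun p => p.1 + Pi.single j p.2) (fun _ _ => Finset.mem_coe.2 (Finset.mem_univ _)) (by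
      rintro ⟨ζ, t⟩ h1 ⟨ζ', t'⟩ h2 he
      simp only [Finset.coe_product, Set.mem_prod, Finset.mem_coe, Finset.mem_filter,
        Finset.mem_univ, true_and, and_true] at h1 h2
      have e1 := hval ζ t h1
      have e2 := hval ζ' t' h2
      simp only at he
      rw [he, e2] at e1
      have ht : t' = t := mul_left_cancel₀ hj' e1
      subst ht
      simpa using he)
  simpa [ZMod.card] using this

/-- The representative in `{1, …, N}` of a vector modulo `N`. -/
def zmodRep {N : ℕ} (ζ : Fin d → ZMod N) (j : Fin d) : ℕ :=
  if (ζ j).val = 0 then N else (ζ j).val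

theorem zmodRep_mem {N : ℕ} [NeZero N] (ζ : Fin d → ZMod N) (j : Fin d) :
    1 ≤ zmodRep ζ j ∧ zmodRep ζ j ≤ N := by
  unfold zmodRep
  have := ZMod.val_lt (ζ j)
  have := NeZero.pos N
  split_ifs <;> omega

theorem natCast_zmodRep {N : ℕ} [NeZero N] (ζ : Fin d → ZMod N) (j : Fin d) :
    ((zmodRep ζ j : ℕ) : ZMod N) = ζ j := by
  unfold zmodRep
  split_ifs with h
  · rw [ZMod.natCast_self, (ZMod.val_eq_zero _).1 h]
  · simp

theorem aliased_zmodRep_iff {N : ℕ} [NeZero N] (ζ : Fin d → ZMod N) (h h' : Fin d → ℤ) :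
    Aliased N (zmodRep ζ) h h' ↔ h ≠ h' ∧ ∑ j, ((h' j - h j : ℤ) : ZMod N) * ζ j = 0 := by
  unfold Aliased
  rw [← ZMod.intCast_zmod_eq_zero_iff_dvd]
  push_cast
  simp only [natCast_zmodRep]

-- Exchange the sums and count, for each pair, the vectors that alias it. Pairs congruent modulo `N`
-- in every coordinate are aliased by all vectors and treated by `tsum_congruent_le`; any other pair
-- satisfies a nontrivial linear equation for at most a fraction `1/N` of the vectors.
open Classical in
theorem sum_aliasingSum_le {q : ℝ} (hq : 0 < q) (hα : 0 ≤ α * q) {N : ℕ} [hN : Fact N.Prime] :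
    ∑ ζ : Fin d → ZMod N,
      aliasingSum (fun h => (korobovCoeff α γ d h : ℝ≥0∞) ^ q) N (zmodRep ζ) ≤
      (N : ℝ≥0∞) ^ d * (((N : ℝ≥0∞)⁻¹ + 2 * (2 / N : ℝ≥0∞) ^ (α * q)) *
        weightSum α γ d q ^ 2) := by
  set b : (Fin d → ℤ) → ℝ≥0∞ := fun h => (korobovCoeff α γ d h : ℝ≥0∞) ^ q with hb
  have hN0 : N ≠ 0 := hN.out.ne_zero
  have hN0' : (N : ℝ≥0∞) ≠ 0 := by exact_mod_cast hN0
  have hcard : ∀ h h' : Fin d → ℤ,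
      ∑ ζ : Fin d → ZMod N, (if Aliased N (zmodRep ζ) h h' then b h * b h' else 0) ≤
      (N : ℝ≥0∞) ^ d * ((N : ℝ≥0∞)⁻¹ * (b h * b h') +
        (if h ≠ h' ∧ ∀ j, (N : ℤ) ∣ h' j - h j then b h * b h' else 0)) := by
    intro h h'
    simp only [aliased_zmodRep_iff]
    by_cases hh : h = h'
    · simp [hh]
    by_cases hdvd : ∀ j, (N : ℤ) ∣ h' j - h j
    · refine le_trans (Finset.sum_le_card_nsmul _ _ (b h * b h') fun ζ _ => ?_) ?_
      · split_ifs
        exacts [le_rfl, zero_le]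
      · simp only [ne_eq, hh, not_false_eq_true, hdvd, implies_true, and_self, if_true,
          Finset.card_univ, Fintype.card_pi, ZMod.card, Finset.prod_const, Fintype.card_fin,
          nsmul_eq_mul, Nat.cast_pow]
        gcongr
        exact le_add_self
    · have hℓ : (fun j => ((h' j - h j : ℤ) : ZMod N)) ≠ 0 := by
        intro h0
        refine hdvd fun j => ?_
        rw [← ZMod.intCast_zmod_eq_zero_iff_dvd]
        exact congrFun h0 j
      have h1 := card_linear_zero_mul_le hℓ
      simp only [ne_eq, hh, not_false_eq_true, true_and, hdvd, if_false, add_zero]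
      rw [← Finset.sum_filter, Finset.sum_const, nsmul_eq_mul,
        ← mul_assoc ((N : ℝ≥0∞) ^ d)]
      refine mul_le_mul' ?_ le_rfl
      rw [← div_eq_mul_inv, ENNReal.le_div_iff_mul_le (Or.inl hN0') (Or.inl (by simp))]
      exact_mod_cast h1
  have hswap : ∑ ζ : Fin d → ZMod N, aliasingSum b N (zmodRep ζ) =
      ∑' h, ∑' h', ∑ ζ : Fin d → ZMod N,
        (if Aliased N (zmodRep ζ) h h' then b h * b h' else 0) := by
    simp only [aliasingSum]
    rw [← Summable.tsum_finsetSum fun _ _ => ENNReal.summable]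
    refine tsum_congr fun h => ?_
    rw [← Summable.tsum_finsetSum fun _ _ => ENNReal.summable]
  rw [hswap]
  refine (ENNReal.tsum_le_tsum fun h => ENNReal.tsum_le_tsum fun h' => hcard h h').trans ?_
  simp only [ENNReal.tsum_mul_left, ENNReal.tsum_add, ENNReal.tsum_mul_right]
  refine mul_le_mul_right ?_ _
  rw [add_mul]
  refine add_le_add ?_ ?_
  · refine mul_le_mul_right ?_ _
    rw [sq]
    exact mul_le_mul' (tsum_korobovCoeff_rpow_le hq) (tsum_korobovCoeff_rpow_le hq)
  · rw [mul_assoc]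
    exact tsum_congruent_le hq hα hN0

theorem aliasingSum_rpow_le (b : (Fin d → ℤ) → ℝ≥0∞) (N : ℕ) (z : Fin d → ℕ) {q : ℝ} (hq0 : 0 < q)
    (hq1 : q ≤ 1) : aliasingSum b N z ^ q ≤ aliasingSum (fun h => b h ^ q) N z := by
  unfold aliasingSum
  refine (ENNReal.rpow_tsum_le_tsum_rpow _ hq0 hq1).trans (ENNReal.tsum_le_tsum fun h => ?_)
  refine (ENNReal.rpow_tsum_le_tsum_rpow _ hq0 hq1).trans (ENNReal.tsum_le_tsum fun h' => ?_)
  split_ifs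
  · rw [ENNReal.mul_rpow_of_nonneg _ _ hq0.le]
  · rw [ENNReal.zero_rpow_of_pos hq0]

/-- The best generating vector is good for all exponents at once. -/
theorem exists_generatingVector (α : ℝ) (γ : Finset ℕ → ℝ≥0) (d : ℕ) {N : ℕ} (hN : N.Prime) :
    ∃ z : Fin d → ℕ, (∀ j, 1 ≤ z j ∧ z j ≤ N) ∧ ∀ q, 0 < q → q ≤ 1 → 1 ≤ α * q →
      aliasingSum (fun h => (korobovCoeff α γ d h : ℝ≥0∞)) N z ^ q ≤
        (N : ℝ≥0∞)⁻¹ * ((1 + 2 * 2 ^ (α * q)) * weightSum α γ d q ^ 2) := by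
  have : Fact N.Prime := ⟨hN⟩
  have hN0' : (N : ℝ≥0∞) ≠ 0 := by exact_mod_cast hN.ne_zero
  -- The minimizer is taken for the aliasing sum without the power `q`, hence before `q` is chosen.
  -- For each `q`, the minimum raised to `q` is at most the average of the sums with `ρ^q`.
  obtain ⟨ζ₀, hζ₀⟩ := Finite.exists_min fun ζ : Fin d → ZMod N =>
    aliasingSum (fun h => (korobovCoeff α γ d h : ℝ≥0∞)) N (zmodRep ζ)
  refine ⟨zmodRep ζ₀, zmodRep_mem ζ₀, fun q hq0 hq1 hαq => ?_⟩
  set S := aliasingSum (fun h => (korobovCoeff α γ d h : ℝ≥0∞)) N (zmodRep ζ₀)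
  have h1 : (N : ℝ≥0∞) ^ d * S ^ q ≤ (N : ℝ≥0∞) ^ d *
      (((N : ℝ≥0∞)⁻¹ + 2 * (2 / N : ℝ≥0∞) ^ (α * q)) * weightSum α γ d q ^ 2) := by
    refine le_trans ?_ (sum_aliasingSum_le hq0 (zero_le_one.trans hαq))
    have h2 := Finset.card_nsmul_le_sum (Finset.univ : Finset (Fin d → ZMod N)) (fun ζ =>
      aliasingSum (fun h => (korobovCoeff α γ d h : ℝ≥0∞) ^ q) N (zmodRep ζ)) (S ^ q) fun ζ _ =>
        (ENNReal.rpow_le_rpow (hζ₀ ζ) hq0.le).trans (aliasingSum_rpow_le _ _ _ hq0 hq1)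
    simpa [nsmul_eq_mul, ZMod.card] using h2
  have h2 := (ENNReal.mul_le_mul_iff_right (pow_ne_zero d hN0')
    (ENNReal.pow_ne_top (by simp))).1 h1
  refine h2.trans ?_
  rw [← mul_assoc, mul_add, mul_one]
  refine mul_le_mul_left (add_le_add_right ?_ _) _
  rw [mul_left_comm]
  refine mul_le_mul_right ?_ _
  rw [div_eq_mul_inv, ENNReal.mul_rpow_of_nonneg _ _ (zero_le_one.trans hαq), mul_comm]
  refine mul_le_mul_left ?_ _
  -- Here `1 ≤ α * q` enters: `N^{-αq} ≤ N⁻¹`, so the congruent pairs do not dominate.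
  have h3 : (N : ℝ≥0∞)⁻¹ ≤ 1 := by
    rw [ENNReal.inv_le_one]
    exact_mod_cast hN.one_lt.le
  simpa using ENNReal.rpow_le_rpow_of_exponent_ge h3 hαq

end Averaging

/-! ### Finiteness and dimension-independent bounds of the weight sums. -/

section WeightBounds

variable {α : ℝ} {γ : Finset ℕ → ℝ≥0} {d : ℕ}

theorem tsum_zetaTerm {a : ℝ} (ha : 1 < a) :
    ∑' k, zetaTerm a k = ENNReal.ofReal (2 * ∑' k : ℕ, ((k : ℝ) + 1) ^ (-a)) := by
  have hs : Summable fun k : ℕ => ((k : ℝ) + 1) ^ (-a) := by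
    have := (summable_nat_add_iff 1).2 (Real.summable_nat_rpow.2 (neg_lt_neg ha))
    exact_mod_cast this
  have hterm : ∀ k : ℕ, zetaTerm a ((k : ℤ) + 1) = ENNReal.ofReal (((k : ℝ) + 1) ^ (-a)) := by
    intro k
    have h0 : (k : ℤ) + 1 ≠ 0 := by omega
    have h1 : ((k : ℤ) + 1).natAbs = k + 1 := by omega
    rw [zetaTerm, if_neg h0, h1, ← ENNReal.ofReal_rpow_of_pos (by positivity)]
    congr 1
    rw [ENNReal.ofReal_add (by positivity) zero_le_one]
    simp
  have hneg : ∀ k : ℕ, zetaTerm a (-((k : ℤ) + 1)) = zetaTerm a ((k : ℤ) + 1) := by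
    intro k
    simp only [zetaTerm, neg_eq_zero, Int.natAbs_neg]
  have hpos : ∑' k : ℕ, zetaTerm a (k : ℤ) = ∑' k : ℕ, zetaTerm a ((k : ℤ) + 1) := by
    rw [tsum_eq_zero_add' ENNReal.summable]
    simp [zetaTerm]
  have key := (HasSum.of_nat_of_neg_add_one (f := zetaTerm a) ENNReal.summable.hasSum
    ENNReal.summable.hasSum).tsum_eq
  simp only [hneg] at key
  rw [key, hpos, ← two_mul, ENNReal.ofReal_mul zero_le_two]
  simp only [hterm]
  rw [ENNReal.ofReal_tsum_of_nonneg (fun k => by positivity) hs]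
  simp

theorem weightSum_ne_top {q : ℝ} (hq : 0 < q) (hαq : 1 < α * q) : weightSum α γ d q ≠ ∞ := by
  rw [weightSum, tsum_zetaTerm hαq]
  refine ENNReal.sum_ne_top.2 fun s _ => ?_
  exact ENNReal.mul_ne_top (ENNReal.mul_ne_top (by simp)
    (ENNReal.rpow_ne_top_of_nonneg hq.le ENNReal.coe_ne_top))
    (ENNReal.pow_ne_top ENNReal.ofReal_ne_top)

theorem one_le_weightSum (hγ : γ ∅ = 1) (q : ℝ) : 1 ≤ weightSum α γ d q := by
  refine le_trans (le_of_eq ?_) (Finset.single_le_sum (fun _ _ => zero_le)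
    (Finset.mem_univ (∅ : Finset (Fin d))))
  simp [hγ]

/-- Subsets of `Fin d` embed into the finite subsets of `ℕ`, so each `weightSum` is a partial sum of
one convergent series. -/
theorem exists_weightSum_le {q : ℝ} (hq : 0 < q) (hαq : 1 < α * q) (h : WeightSummable α γ q) :
    ∃ B : ℝ, ∀ d, (weightSum α γ d q).toReal ≤ B := by
  set Z : ℝ := 2 * ∑' k : ℕ, ((k : ℝ) + 1) ^ (-(α * q)) with hZ
  have hZ0 : 0 ≤ Z := mul_nonneg zero_le_two (tsum_nonneg fun k => by positivity)
  set t : Finset ℕ → ℝ := fun u => (max u.card 1 : ℝ) * (γ u : ℝ) ^ q * Z ^ u.card with ht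
  have ht0 : ∀ u, 0 ≤ t u := fun u => by positivity
  refine ⟨∑' u, t u, fun d => ENNReal.toReal_le_of_le_ofReal (tsum_nonneg ht0) ?_⟩
  rw [ENNReal.ofReal_tsum_of_nonneg ht0 h, weightSum, tsum_zetaTerm hαq, ← hZ]
  clear_value Z
  refine le_trans (le_of_eq ?_) (ENNReal.sum_le_tsum (Finset.univ.map
    (Finset.mapEmbedding (Fin.valEmbedding (n := d))).toEmbedding))
  rw [Finset.sum_map]
  refine Finset.sum_congr rfl fun s _ => ?_
  have hc : (Finset.mapEmbedding (Fin.valEmbedding (n := d))).toEmbedding s =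
    s.map Fin.valEmbedding := rfl
  rw [hc, ht]
  simp only [Finset.card_map]
  rw [ENNReal.ofReal_mul (by positivity), ENNReal.ofReal_mul (by positivity),
    ENNReal.ofReal_pow hZ0, ← ENNReal.ofReal_rpow_of_nonneg (by positivity) hq.le,
    ENNReal.ofReal_coe_nnreal]
  congr 3
  rw [← ENNReal.ofReal_natCast, Nat.cast_max, Nat.cast_one]

theorem one_le_toReal_weightSum (hγ : γ ∅ = 1) {q : ℝ} (hq : 0 < q) (hαq : 1 < α * q) :
    1 ≤ (weightSum α γ d q).toReal := by
  rw [← ENNReal.toReal_one]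
  exact ENNReal.toReal_mono (weightSum_ne_top hq hαq) (one_le_weightSum hγ q)

/-- The embedding of `ℓ^q` into `ℓ^τ` for `q ≤ τ`: a bound at the one exponent `q` serves all larger
exponents. -/
theorem summable_korobovCoeff_rpow {q τ : ℝ} (hq : 0 < q) (hαq : 1 < α * q) (hτ : q ≤ τ) :
    Summable (fun h : Fin d → ℤ => (korobovCoeff α γ d h : ℝ) ^ τ) ∧
      ∑' h : Fin d → ℤ, (korobovCoeff α γ d h : ℝ) ^ τ ≤
        (weightSum α γ d q).toReal ^ (τ / q) := by
  have hτ0 : 0 < τ := hq.trans_le hτ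
  have h1 : ∑' h : Fin d → ℤ, (korobovCoeff α γ d h : ℝ≥0∞) ^ τ ≤
      weightSum α γ d q ^ (τ / q) := by
    have h2 := ENNReal.rpow_tsum_le_tsum_rpow
      (fun h : Fin d → ℤ => (korobovCoeff α γ d h : ℝ≥0∞) ^ τ) (q := q / τ) (by positivity)
      ((div_le_one hτ0).2 hτ)
    simp only [← ENNReal.rpow_mul, mul_div_cancel₀ q hτ0.ne'] at h2
    have h3 := ENNReal.rpow_le_rpow (h2.trans (tsum_korobovCoeff_rpow_le hq))
      (z := τ / q) (by positivity)
    rwa [← ENNReal.rpow_mul, div_mul_div_cancel₀ hτ0.ne', div_self hq.ne', ENNReal.rpow_one] at h3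
  have htop : weightSum α γ d q ^ (τ / q) ≠ ∞ :=
    ENNReal.rpow_ne_top_of_nonneg (by positivity) (weightSum_ne_top hq hαq)
  have e : ∀ h : Fin d → ℤ, (korobovCoeff α γ d h : ℝ≥0∞) ^ τ =
      ENNReal.ofReal ((korobovCoeff α γ d h : ℝ) ^ τ) := fun h => by
    rw [← ENNReal.ofReal_rpow_of_nonneg (NNReal.coe_nonneg _) hτ0.le, ENNReal.ofReal_coe_nnreal]
  simp only [e] at h1
  have hs : Summable (fun h : Fin d → ℤ => (korobovCoeff α γ d h : ℝ) ^ τ) := by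
    have := ENNReal.summable_toReal (ne_top_of_le_ne_top htop h1)
    refine this.congr fun h => ENNReal.toReal_ofReal (by positivity)
  refine ⟨hs, ?_⟩
  rw [← ENNReal.ofReal_tsum_of_nonneg (fun h => by positivity) hs] at h1
  rw [ENNReal.toReal_rpow]
  exact (ENNReal.ofReal_le_iff_le_toReal htop).1 h1

end WeightBounds

/-! ### Primes of prescribed size, by Bertrand's postulate. -/

theorem exists_prime_between {x : ℝ} (hx : 1 ≤ x) : ∃ N : ℕ, N.Prime ∧ x ≤ N ∧ (N : ℝ) ≤ 2 * x := by
  have h0 : ⌊x⌋₊ ≠ 0 := (Nat.floor_pos.2 hx).ne'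
  obtain ⟨p, hp, h1, h2⟩ := Nat.exists_prime_lt_and_le_two_mul ⌊x⌋₊ h0
  refine ⟨p, hp, (Nat.lt_of_floor_lt h1).le, ?_⟩
  have h3 := Nat.floor_le (zero_le_one.trans hx)
  have h4 : (p : ℝ) ≤ 2 * ⌊x⌋₊ := by exact_mod_cast h2
  linarith

/-! ### Error bounds for fixed `λ`, `q` and `τ`. -/

section Rates

open RKHS

variable {α : ℝ} {γ : Finset ℕ → ℝ≥0} {d : ℕ}

/-- A generating vector whose aliasing sum is small for all exponents. -/
def IsGoodVector (α : ℝ) (γ : Finset ℕ → ℝ≥0) (N : ℕ) (z : Fin d → ℕ) : Prop :=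
  ∀ q, 0 < q → q ≤ 1 → 1 ≤ α * q →
    aliasingSum (fun h => (korobovCoeff α γ d h : ℝ≥0∞)) N z ^ q ≤
      (N : ℝ≥0∞)⁻¹ * ((1 + 2 * 2 ^ (α * q)) * weightSum α γ d q ^ 2)

theorem IsGoodVector.exists_bound (hγ : γ ∅ = 1) {N : ℕ} (hN : N ≠ 0) {z : Fin d → ℕ}
    (hz : IsGoodVector α γ N z) {q : ℝ} (hq : 0 < q) (hq1 : q ≤ 1) (hαq : 1 < α * q) :
    ∃ s : ℝ, 0 < s ∧
      aliasingSum (fun h => (korobovCoeff α γ d h : ℝ≥0∞)) N z ≤ ENNReal.ofReal s ∧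
      √s = ((1 + 2 * 2 ^ (α * q)) * (weightSum α γ d q).toReal ^ 2) ^ (1 / (2 * q)) *
        (N : ℝ) ^ (-(1 / (2 * q))) := by
  have hw := one_le_toReal_weightSum (d := d) hγ hq hαq
  set w := (weightSum α γ d q).toReal with hwdef
  have hNpos : (0 : ℝ) < N := by positivity
  set t : ℝ := (N : ℝ)⁻¹ * ((1 + 2 * 2 ^ (α * q)) * w ^ 2) with ht
  have ht0 : 0 < t := by positivity
  refine ⟨t ^ (1 / q), by positivity, ?_, ?_⟩
  · have h1 := hz q hq hq1 hαq.le
    have h2 : (N : ℝ≥0∞)⁻¹ * ((1 + 2 * 2 ^ (α * q)) * weightSum α γ d q ^ 2) =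
        ENNReal.ofReal t := by
      rw [ht, ENNReal.ofReal_mul (by positivity), ENNReal.ofReal_inv_of_pos hNpos,
        ENNReal.ofReal_natCast, ENNReal.ofReal_mul (by positivity),
        ENNReal.ofReal_add zero_le_one (by positivity), ENNReal.ofReal_mul zero_le_two,
        ENNReal.ofReal_pow (by positivity), hwdef, ENNReal.ofReal_toReal (weightSum_ne_top hq hαq),
        ← ENNReal.ofReal_rpow_of_pos two_pos]
      simp
    rw [h2] at h1
    have h3 := ENNReal.rpow_le_rpow h1 (z := 1 / q) (by positivity)
    rwa [← ENNReal.rpow_mul, mul_one_div_cancel hq.ne', ENNReal.rpow_one,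
      ENNReal.ofReal_rpow_of_pos ht0] at h3
  · rw [Real.sqrt_eq_rpow, ← Real.rpow_mul ht0.le, ht, Real.mul_rpow (by positivity) (by positivity),
      mul_comm, Real.inv_rpow hNpos.le, ← Real.rpow_neg hNpos.le]
    have : 1 / q * (1 / 2) = 1 / (2 * q) := by field_simp
    rw [this]

variable {Ω : Type*} [MeasurableSpace Ω] {P : Measure Ω} [IsProbabilityMeasure P]

theorem sq_apply_le_weightSum {q τ : ℝ} (hq : 0 < q) (hαq : 1 < α * q) (hqτ : q ≤ τ) (hτ : τ ≤ 1)
    {lam : ℝ} (hlam : 0 < lam) (v : KorobovSpace α γ d) (y : UnitCube d) :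
    v y ^ 2 ≤ lam ^ (-τ) * (weightSum α γ d q).toReal ^ (τ / q) *
      ((∫ x, v x ^ 2) + lam * ‖v‖ ^ 2) := by
  obtain ⟨hs1, -⟩ := summable_korobovCoeff_rpow (γ := γ) (d := d) hq hαq (hqτ.trans hτ)
  simp only [Real.rpow_one] at hs1
  obtain ⟨hs2, hle⟩ := summable_korobovCoeff_rpow (γ := γ) (d := d) hq hαq hqτ
  obtain ⟨T, hT, -⟩ := exists_fourierIsometry hs1 korobovCoeff_neg
  have h1 := sq_apply_le hs1 hlam (hq.le.trans hqτ) hτ hs2.hasSum (hT v) y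
  rw [T.norm_map] at h1
  refine h1.trans (mul_le_mul_of_nonneg_right (mul_le_mul_of_nonneg_left hle (by positivity)) ?_)
  exact add_nonneg (integral_nonneg fun x => sq_nonneg _) (by positivity)

theorem mise_korobov_le (hγ : γ ∅ = 1) {M N : ℕ} (hM : 1 ≤ M) (hN : N ≠ 0) {z : Fin d → ℕ}
    (hz : IsGoodVector α γ N z) {q τ : ℝ} (hq : 0 < q) (hαq : 1 < α * q) (hqτ : q ≤ τ) (hτ : τ ≤ 1)
    {lam : ℝ} (hlam : 0 < lam) {f : KorobovSpace α γ d} {Y : Fin M → Ω → UnitCube d}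
    (hY : IsSampleOf P Y f) :
    mise P α γ N z lam Y f ≤ ENNReal.ofReal (
      2 * (2 * (((1 + 2 * 2 ^ (α * q)) * (weightSum α γ d q).toReal ^ 2) ^ (1 / (2 * q)) *
        (N : ℝ) ^ (-(1 / (2 * q)))) * ‖f‖ ^ 2 + lam * ‖f‖ ^ 2) +
      2 * ((M : ℝ)⁻¹ * (lam ^ (-τ) * (weightSum α γ d q).toReal ^ (τ / q)))) := by
  obtain ⟨hs1, -⟩ := summable_korobovCoeff_rpow (γ := γ) (d := d) hq hαq (hqτ.trans hτ)
  simp only [Real.rpow_one] at hs1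
  obtain ⟨s, hs, hS, hsq⟩ := hz.exists_bound hγ hN hq (hqτ.trans hτ) hαq
  rw [← hsq]
  exact mise_le hs1 hlam (by positivity) hM (fun _ => rfl) hY
    (sq_apply_le_weightSum hq hαq hqτ hτ hlam)
    fun g hg hgu => integral_sq_bias_le hs1 hN hs hlam hS hg hgu

theorem mise_korobovTilde_le (hγ : γ ∅ = 1) {M N : ℕ} (hM : 1 ≤ M) (hN : N ≠ 0) {z : Fin d → ℕ}
    (hz : IsGoodVector α γ N z) {q τ : ℝ} (hq : 0 < q) (hαq : 1 < α * q) (hqτ : q ≤ τ) (hτ : τ ≤ 1)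
    {lam : ℝ} (hlam : 0 < lam) {f : KorobovTildeSpace α γ d} {Y : Fin M → Ω → UnitCube d}
    (hY : IsSampleOf P Y f) :
    mise P α γ N z lam Y f ≤ ENNReal.ofReal (
      2 * (16 * (((1 + 2 * 2 ^ (α * q)) * (weightSum α γ d q).toReal ^ 2) ^ (1 / (2 * q)) *
        (N : ℝ) ^ (-(1 / (2 * q)))) * ((weightSum α γ d q).toReal ^ (1 / q) * ‖f‖ ^ 2) +
        2 * lam ^ 2 * ‖f‖ ^ 2) +
      2 * ((M : ℝ)⁻¹ * (lam ^ (-τ) * (weightSum α γ d q).toReal ^ (τ / q)))) := by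
  obtain ⟨hs1, hle⟩ := summable_korobovCoeff_rpow (γ := γ) (d := d) hq hαq (hqτ.trans hτ)
  simp only [Real.rpow_one] at hs1 hle
  obtain ⟨s, hs, hS, hsq⟩ := hz.exists_bound hγ hN hq (hqτ.trans hτ) hαq
  rw [← hsq]
  -- Each weight is at most their sum, which is at most `weightSum ^ (1 / q)`; this serves as the
  -- embedding constant of the smaller space.
  obtain ⟨u, hu, hun, hui⟩ := exists_eq_of_sq_kernel hs1 korobovCoeff_neg
    (fun h => (hs1.le_tsum h fun _ _ => NNReal.coe_nonneg _).trans hle) f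
  refine mise_le hs1 hlam (by positivity) hM hu hY (sq_apply_le_weightSum hq hαq hqτ hτ hlam)
    fun g hg hgu => ?_
  refine (integral_sq_bias_le_of_smooth hs1 hN hs hlam (norm_nonneg f) hS hui hg hgu).trans ?_
  gcongr

theorem korobovCoeff_zero (hγ : γ ∅ = 1) : korobovCoeff α γ d 0 = 1 := by
  simp [korobovCoeff, freqSupport, hγ]

end Rates

/-! ### Balancing the parameters. -/

section Rates

variable {α : ℝ} {γ : Finset ℕ → ℝ≥0}

theorem natCast_rpow_neg_le {M N : ℕ} {c e x y r : ℝ} (hM : 1 ≤ M) (hN : 1 ≤ N) (hc : 0 < c)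
    (hy : 0 ≤ y) (hyx : y ≤ x) (her : e * y = r) (h : c * (M : ℝ) ^ e ≤ N) :
    (N : ℝ) ^ (-x) ≤ c ^ (-y) * (M : ℝ) ^ (-r) := by
  have hM' : (0 : ℝ) < M := by positivity
  have hN' : (1 : ℝ) ≤ N := by exact_mod_cast hN
  have h1 : (N : ℝ) ^ (-x) ≤ (N : ℝ) ^ (-y) :=
    Real.rpow_le_rpow_of_exponent_le hN' (neg_le_neg hyx)
  have h2 : (N : ℝ) ^ (-y) ≤ (c * (M : ℝ) ^ e) ^ (-y) :=
    Real.rpow_le_rpow_of_nonpos (by positivity) h (neg_nonpos.2 hy)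
  rw [Real.mul_rpow hc.le (by positivity), ← Real.rpow_mul hM'.le, mul_neg, her] at h2
  exact h1.trans h2

theorem mise_korobov_rate (hα : 1 < α) (hγ : γ ∅ = 1) {z : (d N : ℕ) → Fin d → ℕ}
    (hz : ∀ d N, N.Prime → IsGoodVector α γ N (z d N)) {δ ε c : ℝ} (hδ : 0 < δ) (hδα : δ < α / 4)
    (hε : 0 < ε) (hεα : ε ≤ 1 - 1 / α) (hc : 0 < c) :
    ∃ C : ℕ → ℝ, (∀ d, 0 < C d) ∧
      (WeightSummable α γ (1 / (α - 4 * δ)) →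
        (1 / (α - 4 * δ) ≤ 1 / α + ε ∨ WeightSummable α γ (1 / α + ε)) →
        BddAbove (Set.range C)) ∧
      ∀ d M N : ℕ, 1 ≤ d → 1 ≤ M → N.Prime →
        c * (M : ℝ) ^ (1 / (α / 2 * (1 + ε) + 1 / 2 - 2 * δ * (1 + 1 / α + ε))) ≤ N →
        ∀ (Ω : Type u) [MeasurableSpace Ω] (P : Measure Ω) [IsProbabilityMeasure P]
          (f : KorobovSpace α γ d) (Y : Fin M → Ω → UnitCube d), IsSampleOf P Y f →
          mise P α γ N (z d N) ((M : ℝ) ^ (-1 / (1 + 1 / α + ε))) Y f ≤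
            ENNReal.ofReal (C d * ‖f‖ ^ 2 * (M : ℝ) ^ (-1 / (1 + 1 / α + ε))) := by
  have hα0 : 0 < α := by linarith
  have hα' : 0 < 1 / α := by positivity
  have hy : 0 < α - 4 * δ := by linarith
  set τ := 1 / α + ε with hτ
  set Q := 1 / (α - 4 * δ) with hQ
  -- The lattice bound wants `q ≤ Q`, so that `1/(2q) ≥ 1/(2Q) = α/2 - 2δ`, and the variance bound
  -- needs `q ≤ τ`. Taking the minimum leaves one weight sum to control.
  set q := min Q τ with hq
  have hQ0 : 0 < Q := by positivity
  have hq0 : 0 < q := lt_min hQ0 (by positivity)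
  have hqτ : q ≤ τ := min_le_right _ _
  have hτ1 : τ ≤ 1 := by linarith
  have hαq : 1 < α * q := by
    have h1 : 1 < α * Q := by rw [hQ, mul_one_div, one_lt_div hy]; linarith
    have h2 : 1 < α * τ := by rw [hτ, mul_add, mul_one_div_cancel hα0.ne']; nlinarith
    rw [hq]
    rcases min_choice Q τ with h | h <;> rw [h] <;> assumption
  set w : ℕ → ℝ := fun d => (weightSum α γ d q).toReal with hw
  have hw1 : ∀ d, 1 ≤ w d := fun d => one_le_toReal_weightSum hγ hq0 hαq
  have hw0 : ∀ d, 0 < w d := fun d => zero_lt_one.trans_le (hw1 d)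
  set D : ℝ → ℝ := fun w => ((1 + 2 * 2 ^ (α * q)) * w ^ 2) ^ (1 / (2 * q)) with hD
  set y := α / 2 - 2 * δ with hydef
  refine ⟨fun d => 4 * D (w d) * c ^ (-y) + 2 + 2 * w d ^ (τ / q), fun d => ?_, fun h1 h2 => ?_, ?_⟩
  · have := hw0 d
    positivity
  · have hsum : WeightSummable α γ q := by
      rcases min_choice Q τ with h | h
      · rw [hq, h]
        exact h1
      · rcases h2 with h2 | h2
        · rw [hq, min_eq_left h2]
          exact h1
        · rw [hq, h]
          exact h2
    obtain ⟨B, hB⟩ := exists_weightSum_le hq0 hαq hsum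
    refine ⟨4 * D B * c ^ (-y) + 2 + 2 * B ^ (τ / q), ?_⟩
    rintro _ ⟨d, rfl⟩
    have hwB : w d ≤ B := hB d
    have := hw0 d
    simp only [hD]
    gcongr
  · intro d M N _ hM hN hNM Ω _ P _ f Y hY
    have hMpos : (0 : ℝ) < M := by positivity
    have hs1 := (summable_korobovCoeff_rpow (γ := γ) (d := d) hq0 hαq (hqτ.trans hτ1)).1
    simp only [Real.rpow_one] at hs1
    -- Needed only to multiply the variance term by `‖f‖²`.
    have hf1 := one_le_norm_of_integral_eq_one hs1 korobovCoeff_neg (korobovCoeff_zero hγ)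
      (hY.integral_eq_one (continuous_rkhs hs1 korobovCoeff_neg f) hM)
    have hf2 : 1 ≤ ‖f‖ ^ 2 := one_le_pow₀ hf1
    set r := 1 / (1 + 1 / α + ε) with hr
    have hr' : -1 / (1 + 1 / α + ε) = -r := by rw [hr, neg_div]
    have hr1 : r * (1 + τ) = 1 := by
      rw [hr, hτ, ← add_assoc]
      exact one_div_mul_cancel (by positivity)
    have hNr : (N : ℝ) ^ (-(1 / (2 * q))) ≤ c ^ (-y) * (M : ℝ) ^ (-r) := by
      refine natCast_rpow_neg_le hM hN.one_lt.le hc (by linarith) ?_ ?_ hNM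
      · have h1 : y = 1 / (2 * Q) := by
          rw [hydef, hQ]
          field_simp
          ring
        rw [h1]
        exact one_div_le_one_div_of_le (by positivity)
          (mul_le_mul_of_nonneg_left (min_le_left _ _) zero_le_two)
      -- The reciprocal of the exponent of `M` factors as `y / r`, so the lower bound on `N` makes
      -- `N^{-y}` of order `M^{-r}`.
      · have h1 : α / 2 * (1 + ε) + 1 / 2 - 2 * δ * (1 + 1 / α + ε) = y * (1 + 1 / α + ε) := by
          rw [hydef]
          field_simp
          ring
        have hy0 : y ≠ 0 := by rw [hydef]; linarith
        rw [h1, hr]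
        field_simp
    -- With `λ = M^{-r}` the variance `M⁻¹ λ^{-τ}` equals the penalty bias `λ` exactly when `r (1 +
    -- τ) = 1`.
    have hvar : (M : ℝ)⁻¹ * ((M : ℝ) ^ (-r)) ^ (-τ) = (M : ℝ) ^ (-r) := by
      rw [← Real.rpow_mul hMpos.le, ← Real.rpow_neg_one, ← Real.rpow_add hMpos]
      congr 1
      linear_combination hr1
    rw [hr']
    refine (mise_korobov_le hγ hM hN.ne_zero (hz d N hN) hq0 hαq hqτ hτ1 (by positivity) hY).trans
      (ENNReal.ofReal_le_ofReal ?_)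
    set m := (M : ℝ) ^ (-r) with hm
    have hm0 : 0 < m := by positivity
    have hD0 : 0 ≤ D (w d) := by
      have := hw0 d
      positivity
    change 2 * (2 * (D (w d) * _) * ‖f‖ ^ 2 + m * ‖f‖ ^ 2) +
      2 * ((M : ℝ)⁻¹ * (m ^ (-τ) * w d ^ (τ / q))) ≤ _
    rw [← mul_assoc (M : ℝ)⁻¹, hvar]
    have h1 : D (w d) * (N : ℝ) ^ (-(1 / (2 * q))) * ‖f‖ ^ 2 ≤
        D (w d) * (c ^ (-y) * m) * ‖f‖ ^ 2 := by gcongr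
    have h2 : m * w d ^ (τ / q) * 1 ≤ m * w d ^ (τ / q) * ‖f‖ ^ 2 := by
      have := hw0 d
      gcongr
    linarith

theorem mise_korobovTilde_rate (hα : 1 < α) (hγ : γ ∅ = 1) {z : (d N : ℕ) → Fin d → ℕ}
    (hz : ∀ d N, N.Prime → IsGoodVector α γ N (z d N)) {δ ε c : ℝ} (hδ : 0 < δ) (hδα : δ < α / 4)
    (hε : 0 < ε) (hc : 0 < c) :
    ∃ C : ℕ → ℝ, (∀ d, 0 < C d) ∧
      (WeightSummable α γ (1 / (α - 4 * δ)) →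
        (1 / (α - 4 * δ) ≤ min (1 / α + 2 * ε) 1 ∨
          WeightSummable α γ (min (1 / α + 2 * ε) 1)) →
        BddAbove (Set.range C)) ∧
      ∀ d M N : ℕ, 1 ≤ d → 1 ≤ M → N.Prime →
        c * (M : ℝ) ^ (1 / (α / 2 * (1 + ε) + 1 / 4 - 2 * δ * (1 + 1 / (2 * α) + ε))) ≤ N →
        ∀ (Ω : Type u) [MeasurableSpace Ω] (P : Measure Ω) [IsProbabilityMeasure P]
          (f : KorobovTildeSpace α γ d) (Y : Fin M → Ω → UnitCube d), IsSampleOf P Y f →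
          mise P α γ N (z d N) ((M : ℝ) ^ (-1 / (2 + 1 / α + 2 * ε))) Y f ≤
            ENNReal.ofReal (C d * ‖f‖ ^ 2 * (M : ℝ) ^ (-1 / (1 + 1 / (2 * α) + ε))) := by
  have hα0 : 0 < α := by linarith
  have hα' : 0 < 1 / α := by positivity
  have hα1 : 1 / α < 1 := (div_lt_one hα0).2 hα
  have hy : 0 < α - 4 * δ := by linarith
  -- The cap at `1` is forced by `sq_apply_le`. It keeps `τ > 1/α`, and lowering `τ` only helps the
  -- variance since `M ≥ 1`.
  set τ := min (1 / α + 2 * ε) 1 with hτ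
  set Q := 1 / (α - 4 * δ) with hQ
  set q := min Q τ with hq
  have hQ0 : 0 < Q := by positivity
  have hτα : 1 / α < τ := lt_min (by linarith) hα1
  have hq0 : 0 < q := lt_min hQ0 (hα'.trans hτα)
  have hqτ : q ≤ τ := min_le_right _ _
  have hτ1 : τ ≤ 1 := min_le_right _ _
  have hαq : 1 < α * q := by
    have h1 : 1 < α * Q := by rw [hQ, mul_one_div, one_lt_div hy]; linarith
    have h2 : 1 < α * τ := by rwa [div_lt_iff₀' hα0] at hτα
    rw [hq]
    rcases min_choice Q τ with h | h <;> rw [h] <;> assumption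
  set w : ℕ → ℝ := fun d => (weightSum α γ d q).toReal with hw
  have hw1 : ∀ d, 1 ≤ w d := fun d => one_le_toReal_weightSum hγ hq0 hαq
  have hw0 : ∀ d, 0 < w d := fun d => zero_lt_one.trans_le (hw1 d)
  set D : ℝ → ℝ := fun w => ((1 + 2 * 2 ^ (α * q)) * w ^ 2) ^ (1 / (2 * q)) with hD
  set y := α / 2 - 2 * δ with hydef
  refine ⟨fun d => 32 * D (w d) * c ^ (-y) * w d ^ (1 / q) + 4 + 2 * w d ^ (τ / q), fun d => ?_,
    fun h1 h2 => ?_, ?_⟩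
  · have := hw0 d
    positivity
  · have hsum : WeightSummable α γ q := by
      rcases min_choice Q τ with h | h
      · rw [hq, h]
        exact h1
      · rcases h2 with h2 | h2
        · rw [hq, min_eq_left h2]
          exact h1
        · rw [hq, h]
          exact h2
    obtain ⟨B, hB⟩ := exists_weightSum_le hq0 hαq hsum
    refine ⟨32 * D B * c ^ (-y) * B ^ (1 / q) + 4 + 2 * B ^ (τ / q), ?_⟩
    rintro _ ⟨d, rfl⟩
    have hwB : w d ≤ B := hB d
    have := hw0 d
    have := hw0 d |>.trans_le hwB
    have : 0 ≤ τ / q := div_nonneg (hq0.le.trans hqτ) hq0.le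
    simp only [hD]
    gcongr
  · intro d M N _ hM hN hNM Ω _ P _ f Y hY
    have hMpos : (0 : ℝ) < M := by positivity
    have hM1 : (1 : ℝ) ≤ M := by exact_mod_cast hM
    have hs2 := (summable_korobovCoeff_rpow (γ := γ) (d := d) (τ := 2) hq0 hαq
      (by linarith)).1
    have hs2' : Summable fun h : Fin d → ℤ => ((korobovCoeff α γ d h ^ 2 : ℝ≥0) : ℝ) := by
      simpa using hs2
    have hev : ∀ h : Fin d → ℤ, korobovCoeff α γ d (-h) ^ 2 = korobovCoeff α γ d h ^ 2 :=
      fun h => by rw [korobovCoeff_neg]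
    have hf1 := one_le_norm_of_integral_eq_one hs2' hev
      (by rw [korobovCoeff_zero hγ, one_pow])
      (hY.integral_eq_one (continuous_rkhs hs2' hev f) hM)
    have hf2 : 1 ≤ ‖f‖ ^ 2 := one_le_pow₀ hf1
    set r := 1 / (1 + 1 / (2 * α) + ε) with hr
    have hr' : -1 / (1 + 1 / (2 * α) + ε) = -r := by rw [hr, neg_div]
    -- Here `λ = M^{-r/2}`: the penalty bias is of order `λ²`, so it is `λ²` that matches `M^{-r}`.
    have hr2 : -1 / (2 + 1 / α + 2 * ε) = -(r / 2) := by
      rw [hr]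
      field_simp
    have hr0 : 0 < r := by positivity
    have hr1 : r / 2 * (2 + (1 / α + 2 * ε)) = 1 := by
      rw [hr]
      field_simp
      ring
    have hNr : (N : ℝ) ^ (-(1 / (2 * q))) ≤ c ^ (-y) * (M : ℝ) ^ (-r) := by
      refine natCast_rpow_neg_le hM hN.one_lt.le hc (by linarith) ?_ ?_ hNM
      · have h1 : y = 1 / (2 * Q) := by
          rw [hydef, hQ]
          field_simp
          ring
        rw [h1]
        exact one_div_le_one_div_of_le (by positivity)
          (mul_le_mul_of_nonneg_left (min_le_left _ _) zero_le_two)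
      · have h1 : α / 2 * (1 + ε) + 1 / 4 - 2 * δ * (1 + 1 / (2 * α) + ε) =
            y * (1 + 1 / (2 * α) + ε) := by
          rw [hydef]
          field_simp
          ring
        have hy0 : y ≠ 0 := by rw [hydef]; linarith
        rw [h1, hr]
        field_simp
    have hvar : (M : ℝ)⁻¹ * ((M : ℝ) ^ (-(r / 2))) ^ (-τ) ≤ (M : ℝ) ^ (-r) := by
      rw [← Real.rpow_mul hMpos.le, ← Real.rpow_neg_one, ← Real.rpow_add hMpos]
      refine Real.rpow_le_rpow_of_exponent_le hM1 ?_
      have h1 : r / 2 * τ ≤ r / 2 * (1 / α + 2 * ε) :=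
        mul_le_mul_of_nonneg_left (min_le_left _ _) (by positivity)
      linarith
    have hsq : ((M : ℝ) ^ (-(r / 2))) ^ 2 = (M : ℝ) ^ (-r) := by
      rw [← Real.rpow_natCast, ← Real.rpow_mul hMpos.le]
      congr 1
      push_cast
      ring
    rw [hr', hr2]
    refine (mise_korobovTilde_le hγ hM hN.ne_zero (hz d N hN) hq0 hαq hqτ hτ1 (by positivity)
      hY).trans (ENNReal.ofReal_le_ofReal ?_)
    rw [hsq]
    set m := (M : ℝ) ^ (-r) with hm
    have hm0 : 0 < m := by positivity
    have hwd := hw0 d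
    have hD0 : 0 ≤ D (w d) := by positivity
    change 2 * (16 * (D (w d) * _) * (w d ^ (1 / q) * ‖f‖ ^ 2) + 2 * m * ‖f‖ ^ 2) +
      2 * ((M : ℝ)⁻¹ * (_ * w d ^ (τ / q))) ≤ _
    rw [← mul_assoc (M : ℝ)⁻¹]
    have h1 : D (w d) * (N : ℝ) ^ (-(1 / (2 * q))) * (w d ^ (1 / q) * ‖f‖ ^ 2) ≤
        D (w d) * (c ^ (-y) * m) * (w d ^ (1 / q) * ‖f‖ ^ 2) := by gcongr
    have h2 : (M : ℝ)⁻¹ * ((M : ℝ) ^ (-(r / 2))) ^ (-τ) * w d ^ (τ / q) ≤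
        m * w d ^ (τ / q) := by gcongr
    have h3 : m * w d ^ (τ / q) * 1 ≤ m * w d ^ (τ / q) * ‖f‖ ^ 2 := by gcongr
    linarith

end Rates

/-! ### Assembly of both rates with a common generating vector. -/

theorem mainTheorem5 (α : ℝ) (hα : 1 < α) (γ : Finset ℕ → ℝ≥0) (hγ : γ ∅ = 1) :
    ∃ z : (d N : ℕ) → Fin d → ℕ,
      (∀ d N : ℕ, N.Prime → ∀ j, 1 ≤ z d N j ∧ z d N j ≤ N) ∧
      ∀ δ ε c : ℝ, 0 < δ → δ < α / 4 → 0 < ε → ε ≤ 1 - 1 / α → 0 < c →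
        -- densities in the Korobov space
        ((∃ C : ℕ → ℝ, (∀ d, 0 < C d) ∧
            (WeightSummable α γ (1 / (α - 4 * δ)) →
              (1 / (α - 4 * δ) ≤ 1 / α + ε ∨ WeightSummable α γ (1 / α + ε)) →
              BddAbove (Set.range C)) ∧
            ∀ d M N : ℕ, 1 ≤ d → 1 ≤ M → N.Prime →
              c * (M : ℝ) ^ (1 / (α / 2 * (1 + ε) + 1 / 2 - 2 * δ * (1 + 1 / α + ε))) ≤ N →
              ∀ (Ω : Type u) [MeasurableSpace Ω] (P : Measure Ω) [IsProbabilityMeasure P]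
                (f : KorobovSpace α γ d) (Y : Fin M → Ω → UnitCube d), IsSampleOf P Y f →
                mise P α γ N (z d N) ((M : ℝ) ^ (-1 / (1 + 1 / α + ε))) Y f ≤
                  ENNReal.ofReal (C d * ‖f‖ ^ 2 * (M : ℝ) ^ (-1 / (1 + 1 / α + ε)))) ∧
          ∀ M : ℕ, 1 ≤ M → ∃ N : ℕ, N.Prime ∧
            (M : ℝ) ^ (1 / (α / 2 * (1 + ε) + 1 / 2 - 2 * δ * (1 + 1 / α + ε))) ≤ N ∧
            (N : ℝ) ≤
              2 * (M : ℝ) ^ (1 / (α / 2 * (1 + ε) + 1 / 2 - 2 * δ * (1 + 1 / α + ε)))) ∧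
        -- densities in the smaller space
        ((∃ C : ℕ → ℝ, (∀ d, 0 < C d) ∧
            (WeightSummable α γ (1 / (α - 4 * δ)) →
              (1 / (α - 4 * δ) ≤ min (1 / α + 2 * ε) 1 ∨
                WeightSummable α γ (min (1 / α + 2 * ε) 1)) →
              BddAbove (Set.range C)) ∧
            ∀ d M N : ℕ, 1 ≤ d → 1 ≤ M → N.Prime →
              c * (M : ℝ) ^
                  (1 / (α / 2 * (1 + ε) + 1 / 4 - 2 * δ * (1 + 1 / (2 * α) + ε))) ≤ N →
              ∀ (Ω : Type u) [MeasurableSpace Ω] (P : Measure Ω) [IsProbabilityMeasure P]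
                (f : KorobovTildeSpace α γ d) (Y : Fin M → Ω → UnitCube d), IsSampleOf P Y f →
                mise P α γ N (z d N) ((M : ℝ) ^ (-1 / (2 + 1 / α + 2 * ε))) Y f ≤
                  ENNReal.ofReal (C d * ‖f‖ ^ 2 *
                    (M : ℝ) ^ (-1 / (1 + 1 / (2 * α) + ε)))) ∧
          ∀ M : ℕ, 1 ≤ M → ∃ N : ℕ, N.Prime ∧
            (M : ℝ) ^ (1 / (α / 2 * (1 + ε) + 1 / 4 - 2 * δ * (1 + 1 / (2 * α) + ε))) ≤ N ∧
            (N : ℝ) ≤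
              2 * (M : ℝ) ^
                (1 / (α / 2 * (1 + ε) + 1 / 4 - 2 * δ * (1 + 1 / (2 * α) + ε)))) := by
  have hex := fun (d N : ℕ) (hN : N.Prime) => exists_generatingVector α γ d hN
  choose! z hz1 hz2 using hex
  have hα0 : 0 < α := by linarith
  refine ⟨z, hz1, fun δ ε c hδ hδα hε hεα hc => ⟨⟨?_, fun M hM => ?_⟩, ⟨?_, fun M hM => ?_⟩⟩⟩
  · exact mise_korobov_rate hα hγ (fun d N hN => hz2 d N hN) hδ hδα hε hεα hc
  · refine exists_prime_between (Real.one_le_rpow (by exact_mod_cast hM) (one_div_nonneg.2 ?_))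
    have h1 : α / 2 * (1 + ε) + 1 / 2 - 2 * δ * (1 + 1 / α + ε) =
        (α / 2 - 2 * δ) * (1 + 1 / α + ε) := by
      field_simp
      ring
    rw [h1]
    exact mul_nonneg (by linarith) (by positivity)
  · exact mise_korobovTilde_rate hα hγ (fun d N hN => hz2 d N hN) hδ hδα hε hc
  · refine exists_prime_between (Real.one_le_rpow (by exact_mod_cast hM) (one_div_nonneg.2 ?_))
    have h1 : α / 2 * (1 + ε) + 1 / 4 - 2 * δ * (1 + 1 / (2 * α) + ε) =
        (α / 2 - 2 * δ) * (1 + 1 / (2 * α) + ε) := by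
      field_simp
      ring
    rw [h1]
    exact mul_nonneg (by linarith) (by positivity)
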